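/- Let $\varrho$ be a primitive substitution on a finite alphabet $\mathcal A$ with substitution matrix $M$ ($M_{ij}$ is the number of letters $i$ in $\varrho(j)$), and assume that its Perron--Frobenius eigenvalue $\lambda>1$ is a Pisot--Vijayaraghavan unit of degree $d$. Let $\langle u|$ and $|v\rangle$ be the strictly positive left and right eigenvectors of $M$ for $\lambda$, normalised by $\langle 1|v\rangle=\langle u|v\rangle=1$. Choose tile lengths $\ell_i=\alpha u_i$ with $\alpha>0$ and all $\ell_i\in\mathbb Z[\lambda]$, and let $T_{ij}\subset\mathbb Z[\lambda]$ be the set of positions of the left endpoints of the tiles of type $i$ in the supertile $\varrho(j)$ that starts at $0$. Let $\kappa_2,\dots,\kappa_r$ be the real embeddings of $\mathbb Q(\lambda)$ other than the inclusion, let $\sigma_1,\dots,\sigma_s$ be representatives of the pairs of complex conjugate non-real embeddings, so that $d=r+2s$, and let $$x^\star=(\kappa_2(x),\dots,\kappa_r(x),\operatorname{Re}\sigma_1(x),\operatorname{Im}\sigma_1(x),\dots,\operatorname{Re}\sigma_s(x),\operatorname{Im}\sigma_s(x))\in\mathbb R^{d-1}$$ be the star map on $\mathbb Q(\lambda)$.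 Let $Q$ be the matrix with $(\lambda x)^\star=Qx^\star$, that is, the direct sum of the numbers $\kappa_i(\lambda)$ and the $2\times2$ blocks $\begin{pmatrix}\operatorname{Re}\sigma_j(\lambda)&-\operatorname{Im}\sigma_j(\lambda)\\ \operatorname{Im}\sigma_j(\lambda)&\operatorname{Re}\sigma_j(\lambda)\end{pmatrix}$, and put $R=Q^T$ and $\beta=|\det R|$. For $y\in\mathbb R^{d-1}$, let $B(y)$ be the matrix with entries $B_{ij}(y)=\sum_{x\in T_{ij}}e^{2\pi i\langle x^\star|y\rangle}$, and let $B^{(n)}(y)=B(y)B(Ry)\cdots B(R^{n-1}y)$. Then there is exactly one family $(W_i)_{i\in\mathcal A}$ of non-empty compact subsets of $\mathbb R^{d-1}$ (the Rauzy-fractal windows) with $W_i=\bigcup_j\bigcup_{t\in T_{ij}}(QW_j+t^\star)$ for all $i$. Moreover: 1. For every $y\in\mathbb R^{d-1}$, the limit $C(y)=\lim_{n\to\infty}\beta^nB^{(n)}(y)$ exists, has rank at most $1$, and has the form $C(y)=|c(y)\rangle\langle u|$ with a vector $|c(y)\rangle\in\mathbb C^{\mathcal A}$, where $|c(0)\rangle=|v\rangle$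 and $|c(y)\rangle=C(y)|v\rangle$. 2. There is a number $\eta>0$ such that $\operatorname{vol}(W_i)=\eta v_i$ for all $i$ and such that the inverse Fourier transforms $f_i(y)=\int_{W_i}e^{2\pi i\langle x|y\rangle}\,dx$ satisfy, for all $y\in\mathbb R^{d-1}$, $$|f(y)\rangle=\eta\,|c(y)\rangle=\eta\,C(y)|v\rangle=\eta\lim_{n\to\infty}\beta^nB(y)B(Ry)\cdots B(R^{n-1}y)|v\rangle .$$ -/

import Mathlib

open Filter Topology MeasureTheory
open scoped Matrix FourierTransform

noncomputable section

namespace PisotInflation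

/-- `lam` is a Pisot--Vijayaraghavan unit: an algebraic integer larger than `1` that is a unit in the
ring of algebraic integers and all of whose other conjugates lie in the open unit disk. -/
structure IsPVUnit (lam : ℝ) : Prop where
  isIntegral : IsIntegral ℤ lam
  isIntegral_inv : IsIntegral ℤ lam⁻¹
  one_lt : 1 < lam
  norm_conj_lt : ∀ z : ℂ, Polynomial.aeval z (minpoly ℤ lam) = 0 → z ≠ (lam : ℂ) → ‖z‖ < 1

/-- The number field `ℚ(lam)`, as a subfield of `ℝ`. -/
abbrev Fld (lam : ℝ) : IntermediateField ℚ ℝ := IntermediateField.adjoin ℚ {lam}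

/-- `lam` as an element of `ℚ(lam)`. -/
abbrev gen (lam : ℝ) : Fld lam := IntermediateField.AdjoinSimple.gen ℚ lam

/-- The choice that enters the Minkowski embedding: an enumeration `κ` of the real embeddings of
`ℚ(lam)` other than the inclusion, and an enumeration `σ` of representatives of the pairs of
complex conjugate non-real embeddings. -/
structure ConjEnum (lam : ℝ) (r s : ℕ) where
  κ : Fin r → (Fld lam →+* ℝ)
  σ : Fin s → (Fld lam →+* ℂ)
  κ_injective : Function.Injective κ
  range_κ : Set.range κ = {φ | φ ≠ (Fld lam).val.toRingHom}
  σ_not_isReal : ∀ j, ¬ NumberField.ComplexEmbedding.IsReal (σ j)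
  existsUnique_σ : ∀ φ : Fld lam →+* ℂ, ¬ NumberField.ComplexEmbedding.IsReal φ →
    ∃! j, φ = σ j ∨ φ = NumberField.ComplexEmbedding.conjugate (σ j)

/-- The index set of the internal coordinates: one for each `κ`, two (real and imaginary part) for
each `σ`. Its cardinality is `r + 2 * s = d - 1`, where `d` is the degree of `lam`. -/
abbrev Idx (r s : ℕ) : Type := Fin r ⊕ (Fin 2 × Fin s)

/-- Internal space `ℝ^(d-1)`, with its Euclidean structure and Lebesgue measure. -/
abbrev Internal (r s : ℕ) : Type := EuclideanSpace ℝ (Idx r s)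

/-- The star map `ℚ(lam) → ℝ^(d-1)`. -/
def starMap {lam : ℝ} {r s : ℕ} (e : ConjEnum lam r s) (x : Fld lam) : Internal r s :=
  WithLp.toLp 2 (Sum.elim (fun i => e.κ i x)
    (fun p => if p.1 = 0 then (e.σ p.2 x).re else (e.σ p.2 x).im))

/-- The matrix `Q` that multiplication by `lam` induces in internal space. -/
def Q {lam : ℝ} {r s : ℕ} (e : ConjEnum lam r s) : Matrix (Idx r s) (Idx r s) ℝ :=
  Matrix.fromBlocks (Matrix.diagonal fun i => e.κ i (gen lam)) 0 0
    (Matrix.blockDiagonal fun j =>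
      !![(e.σ j (gen lam)).re, -(e.σ j (gen lam)).im;
         (e.σ j (gen lam)).im, (e.σ j (gen lam)).re])

/-- `R = Qᵀ`. -/
def R {lam : ℝ} {r s : ℕ} (e : ConjEnum lam r s) : Matrix (Idx r s) (Idx r s) ℝ := (Q e)ᵀ

section Substitution

variable {A : Type*} [Fintype A] [DecidableEq A]

/-- The substitution matrix: `M i j` counts the letters `i` in the word `ϱ j`. -/
def substMatrix (ϱ : A → List A) : Matrix A A ℝ :=
  Matrix.of fun i j => ((ϱ j).count i : ℝ)

/-- The displacement set `T i j`: the positions of the left endpoints of the tiles of type `i` in the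
supertile of type `j`, which starts at `0` and is made of tiles with lengths `ℓ`. -/
def T {lam : ℝ} (ϱ : A → List A) (ℓ : A → Fld lam) (i j : A) : Finset (Fld lam) :=
  open Classical in
  ((Finset.range (ϱ j).length).filter fun k => (ϱ j)[k]? = some i).image
    fun k => (((ϱ j).take k).map ℓ).sum

variable {lam : ℝ} {r s : ℕ} (e : ConjEnum lam r s) (ϱ : A → List A) (ℓ : A → Fld lam)

/-- The window equations: `W` is a family of non-empty compact sets with
`W i = ⋃ j, ⋃ t ∈ T i j, Q (W j) + t⋆`. -/
def IsWindowFamily (W : A → Set (Internal r s)) : Prop :=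
  (∀ i, IsCompact (W i) ∧ (W i).Nonempty) ∧
  ∀ i, W i = ⋃ j, ⋃ t ∈ T ϱ ℓ i j, (fun x => Matrix.toEuclideanLin (Q e) x + starMap e t) '' W j

/-- The internal Fourier matrix `B i j y = ∑ x ∈ T i j, exp (2 π i ⟨x⋆, y⟩)`. -/
def B (y : Internal r s) : Matrix A A ℂ :=
  Matrix.of fun i j => ∑ x ∈ T ϱ ℓ i j,
    Complex.exp (2 * Real.pi * Complex.I * (inner ℝ (starMap e x) y : ℝ))

/-- The internal cocycle `B(y) B(R y) ⋯ B(R^(n-1) y)`. -/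
def cocycle : ℕ → Internal r s → Matrix A A ℂ
  | 0, _ => 1
  | n + 1, y => cocycle n y * B e ϱ ℓ (Matrix.toEuclideanLin (R e ^ n) y)

/-- The scaled internal cocycle `β^n B(y) B(R y) ⋯ B(R^(n-1) y)` with `β = |det R|`. -/
def scaledCocycle (n : ℕ) (y : Internal r s) : Matrix A A ℂ :=
  ((|(R e).det| ^ n : ℝ) : ℂ) • cocycle e ϱ ℓ n y

end Substitution

/-- The inverse Fourier transform of the indicator function of a set, that is,
`y ↦ ∫ x in K, exp (2 π i ⟨x, y⟩)`. -/
def indicatorFT {r s : ℕ} (K : Set (Internal r s)) : Internal r s → ℂ :=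
  𝓕⁻ (K.indicator fun _ => (1 : ℂ))

end PisotInflation

end

namespace PisotInflation

/-! Write P = λ⁻¹M, S_n(y) = βⁿB⁽ⁿ⁾(y), and w for the vector of window volumes. Since λ is a unit,
the product of its conjugates is ±1, so β = λ⁻¹ (`abs_det_Q`). Since λ is Pisot, Q and R are
contractions, and Banach's fixed point theorem for tuples of compact sets gives the windows
(`existsUnique_isWindowFamily`).

Subadditivity of volume in the window equations gives w ≤ Pw. Pairing with the positive left
eigenvector u forces equality (`mulVec_eq_of_le`), so w = ηv by Perron–Frobenius, and the volume of
W_i is the sum of the volumes of its pieces. The overlaps therefore do not contribute to integrals,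
and the transforms satisfy f(y) = λ⁻¹B(y)f(Ry) (`indicatorFT_window`). Iteration gives f(y) =
S_n(y)f(Rⁿy). Here f(Rⁿy) → f(0) = ηv, and S_n is dominated entrywise by Pⁿ, hence bounded; so
ηS_n(y)v → f(y).

For an arbitrary vector x, factor S_{k+m}(y) = S_k(y)S_m(Rᵏy). For large k the second factor is
close to S_m(0) = Pᵐ, which is close to |v⟩⟨u| for large m. This gives the limit |c(y)⟩⟨u| with c =
f/η (`tendsto_scaledCocycle_mulVec`).

Positivity of η is a packing argument (`exists_volume_window_pos`): supertiles of level m contain on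
the order of λᵐ tiles, whose positions are algebraic integers with star images close to the windows.
Discreteness of the Minkowski embedding bounds their number by a constant times λᵐ times the volume
of a thickened window, so the windows cannot all be null. -/

theorem IsPVUnit.numberField {lam : ℝ} (h : IsPVUnit lam) : NumberField (Fld lam) where
  to_charZero := inferInstance
  to_finiteDimensional := IntermediateField.adjoin.finiteDimensional h.isIntegral.tower_top

theorem IsPVUnit.gen_isIntegral {lam : ℝ} (h : IsPVUnit lam) : IsIntegral ℤ (gen lam) := by
  have h1 := h.isIntegral
  exact (isIntegral_algHom_iff ((Fld lam).val.restrictScalars ℤ)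
    (x := gen lam) Subtype.val_injective).1 h1

theorem IsPVUnit.gen_inv_isIntegral {lam : ℝ} (h : IsPVUnit lam) : IsIntegral ℤ (gen lam)⁻¹ := by
  have h1 := h.isIntegral_inv
  refine (isIntegral_algHom_iff ((Fld lam).val.restrictScalars ℤ)
    (x := (gen lam)⁻¹) Subtype.val_injective).1 ?_
  simpa using h1

theorem IsPVUnit.gen_ne_zero {lam : ℝ} (h : IsPVUnit lam) : gen lam ≠ 0 := by
  intro h0
  have := congrArg Subtype.val h0
  have h1 := h.one_lt
  simp at this
  linarith

/-! ### Embeddings of ℚ(λ) and the field norm -/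

namespace ConjEnum

variable {lam : ℝ} {r s : ℕ} (e : ConjEnum lam r s)

theorem σ_injective : Function.Injective e.σ := by
  intro j j' h
  obtain ⟨k, -, hk⟩ := e.existsUnique_σ (e.σ j) (e.σ_not_isReal j)
  rw [hk j (Or.inl rfl), hk j' (Or.inl h)]

theorem σ_ne_conjugate (j j' : Fin s) :
    e.σ j ≠ NumberField.ComplexEmbedding.conjugate (e.σ j') := by
  intro h
  obtain ⟨k, -, hk⟩ := e.existsUnique_σ (e.σ j) (e.σ_not_isReal j)
  have : j = j' := by rw [hk j (Or.inl rfl), hk j' (Or.inr h)]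
  subst this
  exact e.σ_not_isReal j h.symm

/-- All complex embeddings of `ℚ(lam)`, listed from a choice of conjugates. -/
noncomputable def embedding : Unit ⊕ Fin r ⊕ Fin s ⊕ Fin s → (Fld lam →+* ℂ)
  | .inl _ => Complex.ofRealHom.comp (Fld lam).val.toRingHom
  | .inr (.inl i) => Complex.ofRealHom.comp (e.κ i)
  | .inr (.inr (.inl j)) => e.σ j
  | .inr (.inr (.inr j)) => NumberField.ComplexEmbedding.conjugate (e.σ j)

theorem isReal_ofRealHom_comp (φ : Fld lam →+* ℝ) :
    NumberField.ComplexEmbedding.IsReal (Complex.ofRealHom.comp φ) := by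
  rw [NumberField.ComplexEmbedding.isReal_iff]
  ext x
  simp

theorem ofRealHom_comp_injective :
    Function.Injective fun φ : Fld lam →+* ℝ => Complex.ofRealHom.comp φ := by
  intro φ ψ h
  ext x
  have := RingHom.congr_fun h x
  simpa using this

theorem κ_ne (i : Fin r) : e.κ i ≠ (Fld lam).val.toRingHom := by
  have : e.κ i ∈ Set.range e.κ := ⟨i, rfl⟩
  rw [e.range_κ] at this
  exact this

/-- Makes the field norm a product over the coordinates of the star map and the inclusion. -/
theorem embedding_bijective : Function.Bijective e.embedding := by
  have hne (φ : Fld lam →+* ℝ) (j : Fin s) : Complex.ofRealHom.comp φ ≠ e.σ j := fun h =>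
    e.σ_not_isReal j (h ▸ isReal_ofRealHom_comp φ)
  have hne' (φ : Fld lam →+* ℝ) (j : Fin s) :
      Complex.ofRealHom.comp φ ≠ NumberField.ComplexEmbedding.conjugate (e.σ j) := fun h =>
    e.σ_not_isReal j (NumberField.ComplexEmbedding.isReal_conjugate_iff.1
      (h ▸ isReal_ofRealHom_comp φ))
  constructor
  · rintro (_ | i | j | j) (_ | i' | j' | j') h <;> simp only [embedding] at h
    · rfl
    · exact absurd (ofRealHom_comp_injective h).symm (e.κ_ne i')
    · exact absurd h (hne _ _)
    · exact absurd h (hne' _ _)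
    · exact absurd (ofRealHom_comp_injective h) (e.κ_ne i)
    · rw [e.κ_injective (ofRealHom_comp_injective h)]
    · exact absurd h (hne _ _)
    · exact absurd h (hne' _ _)
    · exact absurd h.symm (hne _ _)
    · exact absurd h.symm (hne _ _)
    · rw [e.σ_injective h]
    · exact absurd h (e.σ_ne_conjugate _ _)
    · exact absurd h.symm (hne' _ _)
    · exact absurd h.symm (hne' _ _)
    · exact absurd h.symm (e.σ_ne_conjugate _ _)
    · have := congrArg NumberField.ComplexEmbedding.conjugate h
      simp only [star_star] at this
      rw [e.σ_injective this]
  · intro φ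
    by_cases hφ : NumberField.ComplexEmbedding.IsReal φ
    · have hφ' : Complex.ofRealHom.comp hφ.embedding = φ := by
        ext x; simp
      by_cases h : hφ.embedding = (Fld lam).val.toRingHom
      · exact ⟨.inl (), by rw [← hφ', h]; rfl⟩
      · have : hφ.embedding ∈ Set.range e.κ := by rw [e.range_κ]; exact h
        obtain ⟨i, hi⟩ := this
        exact ⟨.inr (.inl i), by rw [← hφ', ← hi]; rfl⟩
    · obtain ⟨j, hj | hj, -⟩ := e.existsUnique_σ φ hφ
      · exact ⟨.inr (.inr (.inl j)), hj.symm⟩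
      · exact ⟨.inr (.inr (.inr j)), hj.symm⟩

theorem abs_norm_eq [NumberField (Fld lam)] (x : Fld lam) :
    |((Algebra.norm ℚ x : ℚ) : ℝ)| =
      |(x : ℝ)| * ((∏ i, |e.κ i x|) * ∏ j, ‖e.σ j x‖ ^ 2) := by
  have h1 : ‖((Algebra.norm ℚ x : ℚ) : ℂ)‖ = ∏ φ : Fld lam →+* ℂ, ‖φ x‖ := by
    rw [← norm_prod]
    have := Algebra.norm_eq_prod_embeddings ℚ ℂ x
    simp only [eq_ratCast] at this
    rw [this]
    congr 1
    exact (Fintype.prod_equiv (RingHom.equivRatAlgHom _ _) _ _ (fun _ => rfl)).symm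
  have h2 : ‖((Algebra.norm ℚ x : ℚ) : ℂ)‖ = |((Algebra.norm ℚ x : ℚ) : ℝ)| := by
    rw [← Real.norm_eq_abs, ← Complex.norm_real]; simp
  rw [← h2, h1, ← e.embedding_bijective.prod_comp (fun φ => ‖φ x‖)]
  simp only [Fintype.prod_sum_type, embedding, Finset.univ_unique, Finset.prod_singleton]
  simp [pow_two, Finset.prod_mul_distrib]

/-- Embeddings are determined on the generator. This transfers the Pisot condition from roots of the
minimal polynomial to embeddings. -/
theorem eq_of_apply_gen_eq (φ : Fld lam →+* ℂ) (h : φ (gen lam) = (lam : ℂ)) :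
    φ = Complex.ofRealHom.comp (Fld lam).val.toRingHom := by
  have : φ.toRatAlgHom = (Complex.ofRealHom.comp (Fld lam).val.toRingHom).toRatAlgHom := by
    refine IntermediateField.adjoin_algHom_ext ℚ ?_
    rintro x hx
    obtain rfl : x = lam := hx
    exact h
  exact congrArg (fun f : Fld lam →ₐ[ℚ] ℂ => (f : Fld lam →+* ℂ)) this

theorem norm_apply_gen_lt (h : IsPVUnit lam) (φ : Fld lam →+* ℂ)
    (hφ : φ ≠ Complex.ofRealHom.comp (Fld lam).val.toRingHom) : ‖φ (gen lam)‖ < 1 := by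
  refine h.norm_conj_lt _ ?_ (fun h' => hφ (eq_of_apply_gen_eq φ h'))
  have h0 : Polynomial.aeval (gen lam) (minpoly ℤ lam) = 0 := by
    apply Subtype.val_injective
    have := Polynomial.aeval_algHom_apply ((Fld lam).val.restrictScalars ℤ) (gen lam)
      (minpoly ℤ lam)
    exact this.symm.trans (minpoly.aeval ℤ lam)
  have := Polynomial.aeval_algHom_apply φ.toIntAlgHom (gen lam) (minpoly ℤ lam)
  rw [h0, map_zero] at this
  exact this

theorem abs_κ_gen_lt (h : IsPVUnit lam) (i : Fin r) : |e.κ i (gen lam)| < 1 := by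
  have := norm_apply_gen_lt h (Complex.ofRealHom.comp (e.κ i))
    (fun h' => e.κ_ne i (ofRealHom_comp_injective h'))
  simpa using this

theorem norm_σ_gen_lt (h : IsPVUnit lam) (j : Fin s) : ‖e.σ j (gen lam)‖ < 1 :=
  norm_apply_gen_lt h (e.σ j) (fun h' => e.σ_not_isReal j (h' ▸ isReal_ofRealHom_comp _))

theorem exists_contraction_ratio (h : IsPVUnit lam) : ∃ ρ : ℝ, 0 ≤ ρ ∧ ρ < 1 ∧
    (∀ i, |e.κ i (gen lam)| ≤ ρ) ∧ ∀ j, ‖e.σ j (gen lam)‖ ≤ ρ := by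
  -- The extra value 0 makes the index set non-empty and the maximum non-negative.
  let f : Option (Fin r ⊕ Fin s) → ℝ := fun o =>
    o.elim 0 (Sum.elim (fun i => |e.κ i (gen lam)|) (fun j => ‖e.σ j (gen lam)‖))
  obtain ⟨k, hk⟩ := Finite.exists_max f
  refine ⟨f k, hk none, ?_, fun i => hk (some (.inl i)), fun j => hk (some (.inr j))⟩
  rcases k with _ | i | j
  · exact one_pos
  · exact e.abs_κ_gen_lt h i
  · exact e.norm_σ_gen_lt h j

end ConjEnum

/-! ### Internal space: the contraction Q, its determinant, discreteness of integers -/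

section Internal

variable {lam : ℝ} {r s : ℕ} (e : ConjEnum lam r s)

theorem starMap_zero : starMap e 0 = 0 := by
  ext k; rcases k with i | ⟨a, j⟩ <;> simp [starMap]

theorem starMap_add (x y : Fld lam) : starMap e (x + y) = starMap e x + starMap e y := by
  ext k; rcases k with i | ⟨a, j⟩
  · simp [starMap]
  · by_cases h : a = 0 <;> simp [starMap, h]

theorem starMap_sub (x y : Fld lam) : starMap e (x - y) = starMap e x - starMap e y := by
  rw [eq_sub_iff_add_eq, ← starMap_add, sub_add_cancel]

/-- Multiplication by `lam` in internal space. -/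
noncomputable abbrev QLin : Internal r s →ₗ[ℝ] Internal r s := Matrix.toEuclideanLin (Q e)

/-- The transpose of multiplication by `lam` in internal space. -/
noncomputable abbrev RLin : Internal r s →ₗ[ℝ] Internal r s := Matrix.toEuclideanLin (R e)

theorem QLin_inl (x : Internal r s) (i : Fin r) :
    QLin e x (.inl i) = e.κ i (gen lam) * x (.inl i) := by
  simp [QLin, Q, Matrix.mulVec, dotProduct,
    Matrix.diagonal_apply]

theorem QLin_inr_zero (x : Internal r s) (j : Fin s) :
    QLin e x (.inr (0, j)) = (e.σ j (gen lam)).re * x (.inr (0, j))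
      - (e.σ j (gen lam)).im * x (.inr (1, j)) := by
  simp [QLin, Q, Matrix.mulVec, dotProduct,
    Matrix.blockDiagonal_apply, Fintype.sum_prod_type, Fin.sum_univ_two]
  ring

theorem QLin_inr_one (x : Internal r s) (j : Fin s) :
    QLin e x (.inr (1, j)) = (e.σ j (gen lam)).im * x (.inr (0, j))
      + (e.σ j (gen lam)).re * x (.inr (1, j)) := by
  simp [QLin, Q, Matrix.mulVec, dotProduct,
    Matrix.blockDiagonal_apply, Fintype.sum_prod_type, Fin.sum_univ_two]

theorem starMap_gen_mul (x : Fld lam) : starMap e (gen lam * x) = QLin e (starMap e x) := by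
  ext k
  rcases k with i | ⟨a, j⟩
  · rw [QLin_inl]; simp [starMap]
  · fin_cases a
    · simp only [Fin.zero_eta]; rw [QLin_inr_zero]; simp [starMap]
    · simp only [Fin.mk_one]; rw [QLin_inr_one]; simp [starMap]; ring

theorem starMap_gen_pow_mul (n : ℕ) (x : Fld lam) :
    starMap e (gen lam ^ n * x) = (QLin e ^ n) (starMap e x) := by
  induction n with
  | zero => simp
  | succ n ih => rw [pow_succ', mul_assoc, starMap_gen_mul, ih, pow_succ']; rfl

theorem internal_norm_sq (x : Internal r s) : ‖x‖ ^ 2 =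
    ∑ i, x (.inl i) ^ 2 + ∑ j, (x (.inr (0, j)) ^ 2 + x (.inr (1, j)) ^ 2) := by
  rw [EuclideanSpace.norm_sq_eq]
  simp [Fintype.sum_prod_type, Fin.sum_univ_two, Finset.sum_add_distrib]

/-- Q acts blockwise: it scales each real coordinate, and on each complex plane it is a rotation
composed with scaling by |σ(λ)|. -/
theorem norm_QLin_le {ρ : ℝ} (hρ : 0 ≤ ρ) (hκ : ∀ i, |e.κ i (gen lam)| ≤ ρ)
    (hσ : ∀ j, ‖e.σ j (gen lam)‖ ≤ ρ) (x : Internal r s) : ‖QLin e x‖ ≤ ρ * ‖x‖ := by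
  refine le_of_sq_le_sq ?_ (by positivity)
  rw [mul_pow, internal_norm_sq, internal_norm_sq, mul_add, Finset.mul_sum, Finset.mul_sum]
  refine add_le_add (Finset.sum_le_sum fun i _ => ?_) (Finset.sum_le_sum fun j _ => ?_)
  · rw [QLin_inl, mul_pow]
    exact mul_le_mul_of_nonneg_right (sq_le_sq.2 (by rw [abs_of_nonneg hρ]; exact hκ i))
      (sq_nonneg _)
  · rw [QLin_inr_zero, QLin_inr_one]
    have h1 : (e.σ j (gen lam)).re ^ 2 + (e.σ j (gen lam)).im ^ 2 ≤ ρ ^ 2 := by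
      have h2 := pow_le_pow_left₀ (norm_nonneg _) (hσ j) 2
      rw [Complex.sq_norm, Complex.normSq_apply] at h2
      linarith
    calc _ = ((e.σ j (gen lam)).re ^ 2 + (e.σ j (gen lam)).im ^ 2) *
          (x (.inr (0, j)) ^ 2 + x (.inr (1, j)) ^ 2) := by ring
      _ ≤ _ := by gcongr

theorem norm_QLin_pow_le {ρ : ℝ} (hρ : 0 ≤ ρ) (hQ : ∀ x, ‖QLin e x‖ ≤ ρ * ‖x‖) (n : ℕ)
    (x : Internal r s) : ‖(QLin e ^ n) x‖ ≤ ρ ^ n * ‖x‖ := by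
  induction n with
  | zero => simp
  | succ n ih =>
    rw [pow_succ', pow_succ', mul_assoc]
    exact (hQ _).trans (by gcongr)

theorem inner_QLin (x y : Internal r s) : inner ℝ (QLin e x) y = inner ℝ x (RLin e y) := by
  have h : RLin e = LinearMap.adjoint (QLin e) := by
    have := Matrix.toEuclideanLin_conjTranspose_eq_adjoint (Q e)
    rwa [Matrix.conjTranspose_eq_transpose_of_trivial] at this
  rw [h, LinearMap.adjoint_inner_right]

/-- A transpose has the same operator norm: ‖Ry‖² = ⟨QRy, y⟩ ≤ ρ‖Ry‖‖y‖. -/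
theorem norm_RLin_le {ρ : ℝ} (hQ : ∀ x, ‖QLin e x‖ ≤ ρ * ‖x‖)
    (y : Internal r s) : ‖RLin e y‖ ≤ ρ * ‖y‖ := by
  rcases eq_or_lt_of_le (norm_nonneg (RLin e y)) with h | h
  · rw [← h]
    exact (norm_nonneg _).trans (hQ y)
  · refine le_of_mul_le_mul_left ?_ h
    calc ‖RLin e y‖ * ‖RLin e y‖ = inner ℝ (RLin e y) (RLin e y) :=
          (real_inner_self_eq_norm_mul_norm _).symm
      _ = inner ℝ (QLin e (RLin e y)) y := (inner_QLin e _ _).symm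
      _ ≤ ‖QLin e (RLin e y)‖ * ‖y‖ := real_inner_le_norm _ _
      _ ≤ (ρ * ‖RLin e y‖) * ‖y‖ := by gcongr; exact hQ _
      _ = _ := by ring

theorem toEuclideanLin_R_pow (n : ℕ) : Matrix.toEuclideanLin (R e ^ n) = RLin e ^ n := by
  simp [RLin]

theorem tendsto_RLin_pow {ρ : ℝ} (hρ : 0 ≤ ρ) (hρ1 : ρ < 1) (hQ : ∀ x, ‖QLin e x‖ ≤ ρ * ‖x‖)
    (y : Internal r s) : Tendsto (fun n => (RLin e ^ n) y) atTop (𝓝 0) := by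
  have hle (n : ℕ) : ‖(RLin e ^ n) y‖ ≤ ρ ^ n * ‖y‖ := by
    induction n with
    | zero => simp
    | succ n ih =>
      rw [pow_succ', pow_succ', mul_assoc]
      exact (norm_RLin_le e hQ _).trans (by gcongr)
  refine squeeze_zero_norm hle ?_
  simpa using (tendsto_pow_atTop_nhds_zero_of_lt_one hρ hρ1).mul_const ‖y‖

theorem det_Q : (Q e).det = (∏ i, e.κ i (gen lam)) * ∏ j, ‖e.σ j (gen lam)‖ ^ 2 := by
  rw [Q, Matrix.det_fromBlocks_zero₂₁, Matrix.det_diagonal, Matrix.det_blockDiagonal]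
  congr 1
  refine Finset.prod_congr rfl fun j _ => ?_
  rw [Matrix.det_fin_two_of, Complex.sq_norm, Complex.normSq_apply]
  ring

theorem one_le_abs_norm [NumberField (Fld lam)] {x : Fld lam} (hx : IsIntegral ℤ x)
    (h0 : x ≠ 0) : 1 ≤ |((Algebra.norm ℚ x : ℚ) : ℝ)| := by
  obtain ⟨m, hm⟩ := IsIntegrallyClosed.isIntegral_iff.1 (Algebra.isIntegral_norm ℚ hx)
  have hne : Algebra.norm ℚ x ≠ 0 := Algebra.norm_ne_zero_iff.2 h0
  rw [← hm] at hne ⊢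
  have hm0 : m ≠ 0 := by rintro rfl; simp at hne
  simpa using (by exact_mod_cast Int.one_le_abs hm0 : (1 : ℝ) ≤ |(m : ℝ)|)

/-- The norms of λ and λ⁻¹ both have absolute value at least 1 and multiply to 1, so |N(λ)| = 1; and
|N(λ)| = λ|det Q|. -/
theorem abs_det_Q (h : IsPVUnit lam) : |(Q e).det| = lam⁻¹ := by
  have := h.numberField
  have h1 := one_le_abs_norm h.gen_isIntegral h.gen_ne_zero
  have h2 := one_le_abs_norm h.gen_inv_isIntegral (inv_ne_zero h.gen_ne_zero)
  have h3 : |((Algebra.norm ℚ (gen lam) : ℚ) : ℝ)| = 1 := by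
    have h3 : |((Algebra.norm ℚ (gen lam) : ℚ) : ℝ)| *
        |((Algebra.norm ℚ (gen lam)⁻¹ : ℚ) : ℝ)| = 1 := by
      rw [← abs_mul, ← Rat.cast_mul, ← map_mul, mul_inv_cancel₀ h.gen_ne_zero, map_one,
        Rat.cast_one, abs_one]
    nlinarith
  rw [e.abs_norm_eq] at h3
  have h4 : (0 : ℝ) < lam := by linarith [h.one_lt]
  rw [det_Q, abs_mul, Finset.abs_prod, abs_of_nonneg (a := ∏ j, _)
    (Finset.prod_nonneg fun _ _ => by positivity)]
  rw [IntermediateField.AdjoinSimple.coe_gen, abs_of_pos h4] at h3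
  exact eq_inv_of_mul_eq_one_right h3

/-- The Minkowski embedding of the integers is discrete. -/
theorem eq_zero_of_abs_lt_one (h : IsPVUnit lam) {x : Fld lam} (hx : IsIntegral ℤ x)
    (h1 : |(x : ℝ)| < 1) (h2 : ‖starMap e x‖ < 1) : x = 0 := by
  have := h.numberField
  by_contra h0
  have h3 := one_le_abs_norm hx h0
  rw [e.abs_norm_eq] at h3
  have hs : ‖starMap e x‖ ^ 2 ≤ 1 := pow_le_one₀ (norm_nonneg _) h2.le
  rw [internal_norm_sq] at hs
  have hA : 0 ≤ ∑ i, starMap e x (.inl i) ^ 2 := by positivity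
  have hB : 0 ≤ ∑ j, (starMap e x (.inr (0, j)) ^ 2 + starMap e x (.inr (1, j)) ^ 2) := by
    positivity
  have hκ (i : Fin r) : |e.κ i x| ≤ 1 := by
    have h4 := Finset.single_le_sum (f := fun i => starMap e x (.inl i) ^ 2)
      (fun i _ => sq_nonneg _) (Finset.mem_univ i)
    have h5 : starMap e x (.inl i) = e.κ i x := rfl
    rw [h5] at h4
    exact sq_le_one_iff_abs_le_one _ |>.1 (by linarith)
  have hσ (j : Fin s) : ‖e.σ j x‖ ^ 2 ≤ 1 := by
    have h4 := Finset.single_le_sum (f := fun j => starMap e x (.inr (0, j)) ^ 2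
      + starMap e x (.inr (1, j)) ^ 2) (fun i _ => by positivity) (Finset.mem_univ j)
    have h5 : starMap e x (.inr (0, j)) = (e.σ j x).re := by simp [starMap]
    have h6 : starMap e x (.inr (1, j)) = (e.σ j x).im := by simp [starMap]
    rw [h5, h6] at h4
    rw [Complex.sq_norm, Complex.normSq_apply]
    nlinarith
  -- All conjugates have modulus at most 1 and |x| < 1, which contradicts |N(x)| ≥ 1.
  have h7 : (∏ i, |e.κ i x|) * ∏ j, ‖e.σ j x‖ ^ 2 ≤ 1 :=
    mul_le_one₀ (Finset.prod_le_one (fun _ _ => abs_nonneg _) fun i _ => hκ i)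
      (Finset.prod_nonneg fun _ _ => by positivity)
      (Finset.prod_le_one (fun _ _ => by positivity) fun j _ => hσ j)
  have h8 : 0 ≤ (∏ i, |e.κ i x|) * ∏ j, ‖e.σ j x‖ ^ 2 := by positivity
  nlinarith [abs_nonneg (x : ℝ)]

end Internal

/-! ### Perron–Frobenius theory by a weighted ℓ¹ contraction -/

section PerronFrobenius

theorem tendsto_matrix {A B ι R : Type*} [TopologicalSpace R] {l : Filter ι} {f : ι → Matrix A B R}
    {M : Matrix A B R} (h : ∀ i j, Tendsto (fun n => f n i j) l (𝓝 (M i j))) :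
    Tendsto f l (𝓝 M) :=
  tendsto_pi_nhds.2 fun i => tendsto_pi_nhds.2 (h i)

variable {A : Type*} [Fintype A]

theorem sum_mul_abs_mulVec_le {N : Matrix A A ℝ} (hN : ∀ i j, 0 ≤ N i j) {u : A → ℝ}
    (hu : ∀ i, 0 < u i) {c : ℝ} (huN : u ᵥ* N = c • u) (x : A → ℝ) :
    ∑ i, u i * |(N *ᵥ x) i| ≤ c * ∑ i, u i * |x i| := by
  calc ∑ i, u i * |(N *ᵥ x) i| ≤ ∑ i, u i * ∑ j, N i j * |x j| := by
        refine Finset.sum_le_sum fun i _ => mul_le_mul_of_nonneg_left ?_ (hu i).le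
        refine (Finset.abs_sum_le_sum_abs _ _).trans_eq ?_
        exact Finset.sum_congr rfl fun j _ => by rw [abs_mul, abs_of_nonneg (hN i j)]
    _ = (u ᵥ* N) ⬝ᵥ (fun j => |x j|) := (Matrix.dotProduct_mulVec u N fun j => |x j|)
    _ = c * ∑ i, u i * |x i| := by rw [huN, smul_dotProduct]; rfl

/-- The non-negative vector Pw − w pairs to zero with the strictly positive u, so it vanishes. -/
theorem mulVec_eq_of_le {P : Matrix A A ℝ} {u : A → ℝ} (hu : ∀ i, 0 < u i) (huP : u ᵥ* P = u)
    {w : A → ℝ} (hw : ∀ i, w i ≤ (P *ᵥ w) i) : P *ᵥ w = w := by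
  have h : ∑ i, u i * ((P *ᵥ w) i - w i) = 0 := by
    have : u ⬝ᵥ (P *ᵥ w - w) = 0 := by
      rw [dotProduct_sub, Matrix.dotProduct_mulVec, huP, sub_self]
    exact this
  rw [Finset.sum_eq_zero_iff_of_nonneg fun i _ =>
    mul_nonneg (hu i).le (sub_nonneg.2 (hw i))] at h
  ext i
  have := (mul_eq_zero.1 (h i (Finset.mem_univ i))).resolve_left (hu i).ne'
  linarith

variable [DecidableEq A]

theorem vecMul_pow_eq {N : Matrix A A ℝ} {u : A → ℝ} (h : u ᵥ* N = u) (n : ℕ) :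
    u ᵥ* N ^ n = u := by
  induction n with
  | zero => simp
  | succ n ih => rw [pow_succ, ← Matrix.vecMul_vecMul, ih, h]

theorem pow_mulVec_eq {N : Matrix A A ℝ} {v : A → ℝ} (h : N *ᵥ v = v) (n : ℕ) :
    N ^ n *ᵥ v = v := by
  induction n with
  | zero => simp
  | succ n ih => rw [pow_succ, ← Matrix.mulVec_mulVec, h, ih]

/-- Doeblin's argument: Pᵏ ≥ δ|v⟩⟨u| entrywise for some k. Subtracting δ|v⟩⟨u| changes nothing on
the kernel of ⟨u|, but leaves a non-negative matrix with left eigenvalue 1 − δ at u, so the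
u-weighted ℓ¹ norm contracts. -/
theorem tendsto_sum_mul_abs_pow_mulVec {P : Matrix A A ℝ} (hP : P.IsPrimitive) {u v : A → ℝ}
    (hu : ∀ i, 0 < u i) (hv : ∀ i, 0 < v i) (huP : u ᵥ* P = u) (huv : u ⬝ᵥ v = 1)
    {x : A → ℝ} (hx : u ⬝ᵥ x = 0) :
    Tendsto (fun n => ∑ i, u i * |(P ^ n *ᵥ x) i|) atTop (𝓝 0) := by
  obtain ⟨k, hk, hpos⟩ := hP.exists_pos_pow
  obtain ⟨δ, hδ, hδP⟩ : ∃ δ > 0, ∀ i j, δ * (v i * u j) ≤ (P ^ k) i j := by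
    rcases isEmpty_or_nonempty A with hA | hA
    · exact ⟨1, one_pos, fun i => hA.elim i⟩
    obtain ⟨p, hp⟩ := Finite.exists_min fun p : A × A => (P ^ k) p.1 p.2 / (v p.1 * u p.2)
    refine ⟨_, div_pos (hpos p.1 p.2) (mul_pos (hv p.1) (hu p.2)), fun i j => ?_⟩
    exact (le_div_iff₀ (mul_pos (hv i) (hu j))).1 (hp (i, j))
  have hstep (y : A → ℝ) : ∑ i, u i * |(P *ᵥ y) i| ≤ ∑ i, u i * |y i| := by
    simpa using sum_mul_abs_mulVec_le hP.nonneg hu (c := 1) (by simpa using huP) y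
  have hkstep (y : A → ℝ) (hy : u ⬝ᵥ y = 0) :
      ∑ i, u i * |(P ^ k *ᵥ y) i| ≤ (1 - δ) * ∑ i, u i * |y i| := by
    have h1 : P ^ k *ᵥ y = (P ^ k - δ • Matrix.vecMulVec v u) *ᵥ y := by
      rw [Matrix.sub_mulVec, Matrix.smul_mulVec, Matrix.vecMulVec_mulVec, hy]
      simp
    rw [h1]
    refine sum_mul_abs_mulVec_le (fun i j => ?_) hu ?_ y
    · have := hδP i j
      simp only [Matrix.sub_apply, Matrix.smul_apply, Matrix.vecMulVec_apply, smul_eq_mul]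
      linarith
    · rw [Matrix.vecMul_sub, vecMul_pow_eq huP, Matrix.vecMul_smul, Matrix.vecMul_vecMulVec, huv,
        one_smul, sub_smul, one_smul]
  have hle (n : ℕ) : ∑ i, u i * |((P ^ k) ^ n *ᵥ x) i| ≤ |1 - δ| ^ n * ∑ i, u i * |x i| := by
    induction n with
    | zero => simp
    | succ n ih =>
      rw [pow_succ', ← Matrix.mulVec_mulVec, pow_succ']
      have h0 : u ⬝ᵥ ((P ^ k) ^ n *ᵥ x) = 0 := by
        rw [Matrix.dotProduct_mulVec, vecMul_pow_eq (vecMul_pow_eq huP k), hx]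
      have hnn : 0 ≤ ∑ i, u i * |((P ^ k) ^ n *ᵥ x) i| :=
        Finset.sum_nonneg fun i _ => mul_nonneg (hu i).le (abs_nonneg _)
      calc _ ≤ (1 - δ) * ∑ i, u i * |((P ^ k) ^ n *ᵥ x) i| := hkstep _ h0
        _ ≤ |1 - δ| * ∑ i, u i * |((P ^ k) ^ n *ᵥ x) i| :=
          mul_le_mul_of_nonneg_right (le_abs_self _) hnn
        _ ≤ |1 - δ| * (|1 - δ| ^ n * ∑ i, u i * |x i|) :=
          mul_le_mul_of_nonneg_left ih (abs_nonneg _)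
        _ = _ := by ring
  -- Evaluating the non-negative matrix Pᵏ − δ|v⟩⟨u| between u and v gives 1 − δ ≥ 0.
  have hδ1 : |1 - δ| < 1 := by
    have h1 : δ ≤ 1 := by
      have h2 : u ⬝ᵥ (P ^ k - δ • Matrix.vecMulVec v u) *ᵥ v = 1 - δ := by
        rw [Matrix.dotProduct_mulVec, Matrix.vecMul_sub, vecMul_pow_eq huP, Matrix.vecMul_smul,
          Matrix.vecMul_vecMulVec, huv, one_smul, sub_dotProduct, smul_dotProduct, huv]
        simp
      have h3 : 0 ≤ u ⬝ᵥ (P ^ k - δ • Matrix.vecMulVec v u) *ᵥ v := by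
        refine Finset.sum_nonneg fun i _ => mul_nonneg (hu i).le
          (Finset.sum_nonneg fun j _ => mul_nonneg ?_ (hv j).le)
        have := hδP i j
        simp only [Matrix.sub_apply, Matrix.smul_apply, Matrix.vecMulVec_apply, smul_eq_mul]
        linarith
      linarith
    rw [abs_of_nonneg (by linarith)]
    linarith
  -- Monotonicity extends the decay from multiples of k to all exponents.
  have hmono : ∀ m n, ∑ i, u i * |(P ^ (m + n) *ᵥ x) i| ≤ ∑ i, u i * |(P ^ n *ᵥ x) i| := by
    intro m n
    induction m with
    | zero => simp
    | succ m ih =>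
      rw [Nat.add_right_comm, pow_succ', ← Matrix.mulVec_mulVec]
      exact (hstep _).trans ih
  refine squeeze_zero (fun n => Finset.sum_nonneg fun i _ => mul_nonneg (hu i).le (abs_nonneg _))
    (fun n => ?_) (g := fun n => |1 - δ| ^ (n / k) * ∑ i, u i * |x i|) ?_
  · have := hmono (n % k) (k * (n / k))
    rw [Nat.mod_add_div, pow_mul] at this
    exact this.trans (hle _)
  · simpa using ((tendsto_pow_atTop_nhds_zero_of_lt_one (abs_nonneg _) hδ1).comp
      (Nat.tendsto_div_const_atTop hk.ne')).mul_const (∑ i, u i * |x i|)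

/-- When ⟨u|v⟩ = 1, e_j − u_j v is the component of e_j in the kernel of ⟨u|, so its decay controls
the j-th column of Pⁿ. -/
theorem pow_mulVec_single_sub {P : Matrix A A ℝ} {u v : A → ℝ} (hPv : P *ᵥ v = v) (n : ℕ)
    (i j : A) : (P ^ n *ᵥ (Pi.single j 1 - u j • v)) i = (P ^ n) i j - v i * u j := by
  rw [Matrix.mulVec_sub, Matrix.mulVec_smul, pow_mulVec_eq hPv]
  simp [mul_comm]

/-- Powers of a primitive matrix with spectral radius `1` converge to the rank one projection. -/
theorem tendsto_pow_of_isPrimitive {P : Matrix A A ℝ} (hP : P.IsPrimitive) {u v : A → ℝ}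
    (hu : ∀ i, 0 < u i) (hv : ∀ i, 0 < v i) (huP : u ᵥ* P = u) (hPv : P *ᵥ v = v)
    (huv : u ⬝ᵥ v = 1) :
    Tendsto (fun n => P ^ n) atTop (𝓝 (Matrix.vecMulVec v u)) := by
  refine tendsto_matrix fun i j => ?_
  have hx : u ⬝ᵥ (Pi.single j 1 - u j • v) = 0 := by
    rw [dotProduct_sub, dotProduct_smul, huv]; simp
  have h := tendsto_sum_mul_abs_pow_mulVec hP hu hv huP huv hx
  have hle (n : ℕ) : ‖(P ^ n) i j - v i * u j‖ ≤
      (u i)⁻¹ * ∑ i, u i * |(P ^ n *ᵥ (Pi.single j 1 - u j • v)) i| := by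
    rw [← pow_mulVec_single_sub hPv, Real.norm_eq_abs]
    generalize P ^ n *ᵥ (Pi.single j 1 - u j • v) = y
    rw [← div_eq_inv_mul, le_div_iff₀ (hu i), mul_comm |y i|]
    exact Finset.single_le_sum (f := fun i => u i * |y i|)
      (fun i _ => mul_nonneg (hu i).le (abs_nonneg _)) (Finset.mem_univ i)
  have h0 := h.const_mul (u i)⁻¹
  rw [mul_zero] at h0
  have h1 := squeeze_zero_norm hle h0
  rw [Matrix.vecMulVec_apply]
  exact tendsto_sub_nhds_zero_iff.1 h1

theorem eq_smul_of_mulVec_eq {P : Matrix A A ℝ} (hP : P.IsPrimitive) {u v : A → ℝ}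
    (hu : ∀ i, 0 < u i) (hv : ∀ i, 0 < v i) (huP : u ᵥ* P = u) (hPv : P *ᵥ v = v)
    (huv : u ⬝ᵥ v = 1) {w : A → ℝ} (hw : P *ᵥ w = w) : w = (u ⬝ᵥ w) • v := by
  have h := tendsto_pow_of_isPrimitive hP hu hv huP hPv huv
  have h1 : Tendsto (fun n => P ^ n *ᵥ w) atTop (𝓝 (Matrix.vecMulVec v u *ᵥ w)) :=
    ((continuous_id.matrix_mulVec continuous_const).tendsto _).comp h
  simp only [pow_mulVec_eq hw, Matrix.vecMulVec_mulVec] at h1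
  have := tendsto_nhds_unique tendsto_const_nhds h1
  refine this.trans ?_
  ext
  simp [mul_comm]

end PerronFrobenius

/-! ### Existence and uniqueness of the windows -/

section Windows

open Metric TopologicalSpace

theorem hausdorffEDist_image_le_of_lipschitzWith {X Y : Type*} [PseudoEMetricSpace X]
    [PseudoEMetricSpace Y] {K : NNReal} {f : X → Y} (hf : LipschitzWith K f)
    (s t : NonemptyCompacts X) : hausdorffEDist (f '' s) (f '' t) ≤ K * hausdorffEDist (s : Set X) t := by
  have key (s t : NonemptyCompacts X) (x : X) (hx : x ∈ s) :
      ∃ y ∈ f '' t, edist (f x) y ≤ K * hausdorffEDist (s : Set X) t := by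
    obtain ⟨y, hy, hxy⟩ := t.isCompact.exists_infEDist_eq_edist t.nonempty x
    refine ⟨f y, ⟨y, hy, rfl⟩, (hf x y).trans ?_⟩
    rw [← hxy]
    gcongr
    exact infEDist_le_hausdorffEDist_of_mem hx
  refine hausdorffEDist_le_of_mem_edist ?_ ?_
  · rintro _ ⟨x, hx, rfl⟩
    exact key s t x hx
  · rintro _ ⟨x, hx, rfl⟩
    rw [hausdorffEDist_comm]
    exact key t s x hx

variable {A : Type*} [Fintype A] [DecidableEq A] {lam : ℝ} {r s : ℕ} (e : ConjEnum lam r s)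
  (ϱ : A → List A) (ℓ : A → Fld lam)

/-- The affine map `x ↦ Q x + t⋆`. -/
noncomputable abbrev affineQ (t : Fld lam) (x : Internal r s) : Internal r s :=
  Matrix.toEuclideanLin (Q e) x + starMap e t

theorem continuous_affineQ (t : Fld lam) : Continuous (affineQ e t) :=
  (LinearMap.continuous_of_finiteDimensional (QLin e)).add continuous_const

theorem lipschitzWith_affineQ {ρ : NNReal} (hQ : ∀ x, ‖QLin e x‖ ≤ ρ * ‖x‖) (t : Fld lam) :
    LipschitzWith ρ (affineQ e t) := by
  refine LipschitzWith.of_dist_le_mul fun x y => ?_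
  simpa [dist_eq_norm, affineQ, ← map_sub] using hQ (x - y)

/-- The map on families of non-empty compact sets whose fixed points are the window families. -/
noncomputable def windowMap (hT : ∀ i, ∃ j, (T ϱ ℓ i j).Nonempty)
    (W : A → NonemptyCompacts (Internal r s)) (i : A) : NonemptyCompacts (Internal r s) where
  carrier := ⋃ j, ⋃ t ∈ T ϱ ℓ i j, affineQ e t '' W j
  isCompact' := isCompact_iUnion fun j => (T ϱ ℓ i j).isCompact_biUnion fun t _ =>
    (W j).isCompact.image (continuous_affineQ e t)
  nonempty' := by
    obtain ⟨j, t, ht⟩ := hT i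
    obtain ⟨x, hx⟩ := (W j).nonempty
    exact ⟨affineQ e t x, Set.mem_iUnion.2 ⟨j, Set.mem_iUnion₂.2 ⟨t, ht, x, hx, rfl⟩⟩⟩

/-- The Hausdorff distance of two unions is at most the supremum of the distances of their members,
and each affine piece contracts by ρ. -/
theorem contractingWith_windowMap (hT : ∀ i, ∃ j, (T ϱ ℓ i j).Nonempty) {ρ : NNReal} (hρ : ρ < 1)
    (hQ : ∀ x, ‖QLin e x‖ ≤ ρ * ‖x‖) : ContractingWith ρ (windowMap e ϱ ℓ hT) := by
  refine ⟨hρ, fun W W' => edist_pi_le_iff.2 fun i => ?_⟩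
  refine (hausdorffEDist_iUnion_le).trans (iSup_le fun j => ?_)
  refine (hausdorffEDist_iUnion_le).trans (iSup_le fun t => ?_)
  refine (hausdorffEDist_iUnion_le).trans (iSup_le fun _ => ?_)
  refine (hausdorffEDist_image_le_of_lipschitzWith (lipschitzWith_affineQ e hQ t) _ _).trans ?_
  gcongr
  exact edist_le_pi_edist W W' j

theorem existsUnique_isWindowFamily (hT : ∀ i, ∃ j, (T ϱ ℓ i j).Nonempty) {ρ : NNReal}
    (hρ : ρ < 1) (hQ : ∀ x, ‖QLin e x‖ ≤ ρ * ‖x‖) :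
    ∃! W : A → Set (Internal r s), IsWindowFamily e ϱ ℓ W := by
  have hc := contractingWith_windowMap e ϱ ℓ hT hρ hQ
  have : Nonempty (A → NonemptyCompacts (Internal r s)) := ⟨fun _ => {0}⟩
  refine ⟨fun i => hc.fixedPoint _ i, ⟨fun i => ⟨NonemptyCompacts.isCompact _,
    NonemptyCompacts.nonempty _⟩, fun i => ?_⟩, ?_⟩
  · exact congrArg (fun W => (W i : Set (Internal r s))) hc.fixedPoint_isFixedPt.symm
  · rintro W ⟨hW, hW'⟩
    let W₀ : A → NonemptyCompacts (Internal r s) := fun i => ⟨⟨W i, (hW i).1⟩, (hW i).2⟩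
    have hfix : Function.IsFixedPt (windowMap e ϱ ℓ hT) W₀ := by
      funext i
      exact NonemptyCompacts.ext (hW' i).symm
    rw [← hc.fixedPoint_unique hfix]
    rfl

end Windows

/-! ### Supertiles and their displacement sets -/

section Tilings

theorem _root_.List.card_filter_getElem?_eq_count {A : Type*} [DecidableEq A] (l : List A)
    (i : A) : ((Finset.range l.length).filter fun k => l[k]? = some i).card = l.count i := by
  induction l with
  | nil => simp
  | cons a l ih =>
    rw [Finset.card_filter] at ih ⊢
    rw [List.length_cons, Finset.sum_range_succ']
    simp only [List.getElem?_cons_succ, List.getElem?_cons_zero, ih, List.count_cons,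
      Option.some_inj, beq_iff_eq]

theorem _root_.List.eq_take_append_cons_drop {A : Type*} {l : List A} {k : ℕ} {i : A}
    (h : l[k]? = some i) : l = l.take k ++ i :: l.drop (k + 1) := by
  obtain ⟨hk, rfl⟩ := List.getElem?_eq_some_iff.1 h
  rw [← List.drop_eq_getElem_cons hk, List.take_append_drop]

theorem _root_.List.exists_mem_Ico_sum_take {A : Type*} (f : A → ℝ) (l : List A) (x : ℝ)
    (h0 : 0 ≤ x) (hx : x < (l.map f).sum) : ∃ k i, l[k]? = some i ∧
      ((l.take k).map f).sum ≤ x ∧ x < ((l.take k).map f).sum + f i := by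
  induction l generalizing x with
  | nil => simp at hx; linarith
  | cons a l ih =>
    by_cases h : x < f a
    · exact ⟨0, a, by simp, by simpa using h0, by simpa using h⟩
    · rw [List.map_cons, List.sum_cons] at hx
      obtain ⟨k, i, hk, h1, h2⟩ := ih (x - f a) (by linarith) (by linarith)
      refine ⟨k + 1, i, by simpa using hk, ?_, ?_⟩ <;>
        simp only [List.take_succ_cons, List.map_cons, List.sum_cons] <;> linarith

variable {A : Type*} {lam : ℝ} (ϱ : A → List A) (ℓ : A → Fld lam)

theorem coe_list_sum (l : List A) :
    (((l.map ℓ).sum : Fld lam) : ℝ) = (l.map fun i => (ℓ i : ℝ)).sum := by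
  induction l with
  | nil => simp
  | cons a l ih => simp [ih]

/-- If half-open intervals cover `[0, a)` then their total length is at least `a`. -/
theorem le_sum_card_mul_of_cover [Fintype A] {a : ℝ} {L : A → ℝ} (hL : ∀ i, 0 ≤ L i)
    (F : A → Finset (Fld lam))
    (h : ∀ x, 0 ≤ x → x < a → ∃ i, ∃ t ∈ F i, (t : ℝ) ≤ x ∧ x < t + L i) :
    a ≤ ∑ i, (F i).card * L i := by
  have h1 : Set.Ico 0 a ⊆ ⋃ i ∈ (Finset.univ : Finset A), ⋃ t ∈ F i,
      Set.Ico (t : ℝ) (t + L i) := by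
    rintro x ⟨h0, hx⟩
    obtain ⟨i, t, ht, h2⟩ := h x h0 hx
    simp only [Set.mem_iUnion]
    exact ⟨i, Finset.mem_univ i, t, ht, h2⟩
  have h2 := (measure_mono (μ := volume) h1).trans ((measure_biUnion_finset_le _ _).trans
    (Finset.sum_le_sum fun i _ => measure_biUnion_finset_le _ _))
  simp only [Real.volume_Ico, sub_zero, add_sub_cancel_left, Finset.sum_const] at h2
  have h3 : ∑ i, (F i).card • ENNReal.ofReal (L i) =
      ENNReal.ofReal (∑ i, (F i).card * L i) := by
    rw [ENNReal.ofReal_sum_of_nonneg fun i _ => mul_nonneg (Nat.cast_nonneg _) (hL i)]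
    refine Finset.sum_congr rfl fun i _ => ?_
    rw [ENNReal.ofReal_mul (Nat.cast_nonneg _), ENNReal.ofReal_natCast, nsmul_eq_mul]
  rw [h3] at h2
  exact (ENNReal.ofReal_le_ofReal_iff
    (Finset.sum_nonneg fun i _ => mul_nonneg (Nat.cast_nonneg _) (hL i))).1 h2

variable [DecidableEq A] {ϱ ℓ}

theorem mem_T {i j : A} {t : Fld lam} : t ∈ T ϱ ℓ i j ↔
    ∃ k, (ϱ j)[k]? = some i ∧ (((ϱ j).take k).map ℓ).sum = t := by
  simp only [T, Finset.mem_image, Finset.mem_filter, Finset.mem_range]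
  constructor
  · rintro ⟨k, ⟨-, hk⟩, h⟩
    exact ⟨k, hk, h⟩
  · rintro ⟨k, hk, h⟩
    exact ⟨k, ⟨(List.getElem?_eq_some_iff.1 hk).1, hk⟩, h⟩

theorem card_T_le (i j : A) : ((T ϱ ℓ i j).card : ℝ) ≤ substMatrix ϱ i j := by
  have : (T ϱ ℓ i j).card ≤ (ϱ j).count i :=
    Finset.card_image_le.trans_eq (List.card_filter_getElem?_eq_count _ _)
  simpa [substMatrix] using this

theorem T_nonempty {i j : A} (h : 0 < substMatrix ϱ i j) : (T ϱ ℓ i j).Nonempty := by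
  have h1 : 0 < (ϱ j).count i := by simpa [substMatrix] using h
  obtain ⟨k, hk⟩ := List.getElem?_of_mem (List.count_pos_iff.1 h1)
  exact ⟨_, mem_T.2 ⟨k, hk, rfl⟩⟩

theorem isIntegral_of_mem_T (hℓ : ∀ i, IsIntegral ℤ (ℓ i)) {i j : A} {t : Fld lam}
    (ht : t ∈ T ϱ ℓ i j) : IsIntegral ℤ t := by
  obtain ⟨k, -, rfl⟩ := mem_T.1 ht
  induction (ϱ j).take k with
  | nil => simpa using isIntegral_zero
  | cons a l ih =>
    rw [List.map_cons, List.sum_cons]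
    exact (hℓ a).add ih

theorem bounds_of_mem_T (hℓ : ∀ i, 0 < (ℓ i : ℝ))
    (hsum : ∀ j, (((ϱ j).map ℓ).sum : ℝ) = lam * ℓ j) {i j : A} {t : Fld lam}
    (ht : t ∈ T ϱ ℓ i j) : 0 ≤ (t : ℝ) ∧ (t : ℝ) + ℓ i ≤ lam * ℓ j := by
  obtain ⟨k, hk, rfl⟩ := mem_T.1 ht
  have hnn (l : List A) : (0 : ℝ) ≤ ((l.map ℓ).sum : Fld lam) := by
    rw [coe_list_sum]
    exact List.sum_nonneg (by simpa using fun a _ => (hℓ a).le)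
  refine ⟨hnn _, ?_⟩
  rw [← hsum j]
  conv_rhs => rw [List.eq_take_append_cons_drop hk]
  have := hnn ((ϱ j).drop (k + 1))
  rw [List.map_append, List.map_cons, List.sum_append, List.sum_cons, IntermediateField.coe_add,
    IntermediateField.coe_add]
  linarith

theorem exists_mem_T_of_mem_Ico (hsum : ∀ j, (((ϱ j).map ℓ).sum : ℝ) = lam * ℓ j) {j : A} {x : ℝ}
    (h0 : 0 ≤ x) (hx : x < lam * ℓ j) :
    ∃ i, ∃ t ∈ T ϱ ℓ i j, (t : ℝ) ≤ x ∧ x < t + ℓ i := by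
  rw [← hsum j, coe_list_sum] at hx
  obtain ⟨k, i, hk, h1, h2⟩ := List.exists_mem_Ico_sum_take _ _ x h0 hx
  refine ⟨i, _, mem_T.2 ⟨k, hk, rfl⟩, ?_⟩
  rw [coe_list_sum]
  exact ⟨h1, h2⟩

variable [Fintype A]

theorem list_sum_map_eq (ϱ : A → List A) (f : A → ℝ) (j : A) :
    ((ϱ j).map f).sum = (f ᵥ* substMatrix ϱ) j := by
  rw [Finset.sum_list_map_count, Finset.sum_subset (Finset.subset_univ _)]
  · refine Finset.sum_congr rfl fun i _ => ?_
    simp [substMatrix, mul_comm]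
  · intro i _ hi
    rw [List.count_eq_zero_of_not_mem (by simpa using hi), zero_smul]

/-- No two occurrences share a position: the tiles recorded in the sets T cover an interval of
length λℓ_j, which is the total length with multiplicity, so every inequality in `card_T_le` is
tight. -/
theorem card_T (hℓ : ∀ i, 0 < (ℓ i : ℝ))
    (hsum : ∀ j, (((ϱ j).map ℓ).sum : ℝ) = lam * ℓ j) (i j : A) :
    ((T ϱ ℓ i j).card : ℝ) = substMatrix ϱ i j := by
  have h1 := le_sum_card_mul_of_cover (fun i => (hℓ i).le) (fun i => T ϱ ℓ i j)
    (fun x h0 hx => exists_mem_T_of_mem_Ico hsum h0 hx)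
  have h2 : lam * ℓ j = ∑ i, substMatrix ϱ i j * (ℓ i : ℝ) := by
    rw [← hsum, coe_list_sum, list_sum_map_eq]
    exact Finset.sum_congr rfl fun i _ => mul_comm _ _
  rw [h2] at h1
  have h3 : ∀ i ∈ Finset.univ, ((T ϱ ℓ i j).card : ℝ) * ℓ i ≤ substMatrix ϱ i j * (ℓ i : ℝ) :=
    fun i _ => mul_le_mul_of_nonneg_right (card_T_le i j) (hℓ i).le
  have h4 := (Finset.sum_eq_sum_iff_of_le h3).1 (le_antisymm (Finset.sum_le_sum h3) h1) i
    (Finset.mem_univ i)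
  exact mul_right_cancel₀ (hℓ i).ne' h4

variable {r s : ℕ} (e : ConjEnum lam r s)

/-- The left endpoints of the tiles of the supertile of level `n`. -/
theorem exists_level_tiles (hlam : IsPVUnit lam) (hℓint : ∀ i, IsIntegral ℤ (ℓ i))
    (hℓ : ∀ i, 0 < (ℓ i : ℝ)) (hsum : ∀ j, (((ϱ j).map ℓ).sum : ℝ) = lam * ℓ j)
    {W : A → Set (Internal r s)} (hW : IsWindowFamily e ϱ ℓ W) (j : A) (n : ℕ) :
    ∃ F : A → Finset (Fld lam),
      (∀ i, ∀ x ∈ F i, IsIntegral ℤ x ∧ 0 ≤ (x : ℝ) ∧ (x : ℝ) + ℓ i ≤ lam ^ n * ℓ j ∧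
        ∀ w ∈ W j, (QLin e ^ n) w + starMap e x ∈ W i) ∧
      ∀ x, 0 ≤ x → x < lam ^ n * ℓ j → ∃ i, ∃ t ∈ F i, (t : ℝ) ≤ x ∧ x < t + ℓ i := by
  classical
  have hpos : 0 < lam := one_pos.trans hlam.one_lt
  induction n with
  | zero =>
    refine ⟨fun i => if i = j then {0} else ∅, fun i x hx => ?_, fun x h0 hx => ?_⟩
    · by_cases hij : i = j
      · subst hij
        simp only [if_true, Finset.mem_singleton] at hx
        subst hx
        refine ⟨isIntegral_zero, le_rfl, by simp, fun w hw => ?_⟩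
        rw [starMap_zero]
        simpa using hw
      · simp [hij] at hx
    · exact ⟨j, 0, by simp, by simpa using h0, by simpa using hx⟩
  | succ n ih =>
    obtain ⟨F, hF, hcov⟩ := ih
    -- Inflate each tile of level n by λ and subdivide it by the substitution.
    refine ⟨fun i => Finset.univ.biUnion fun k =>
      Finset.image₂ (fun t x => gen lam * x + t) (T ϱ ℓ i k) (F k), fun i x hx => ?_,
      fun y h0 hy => ?_⟩
    · simp only [Finset.mem_biUnion, Finset.mem_univ, true_and, Finset.mem_image₂] at hx
      obtain ⟨k, t, ht, x, hx, rfl⟩ := hx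
      obtain ⟨h1, h2, h3, h4⟩ := hF k x hx
      obtain ⟨h5, h6⟩ := bounds_of_mem_T hℓ hsum ht
      refine ⟨(hlam.gen_isIntegral.mul h1).add (isIntegral_of_mem_T hℓint ht), ?_, ?_, ?_⟩
      · push_cast
        rw [IntermediateField.AdjoinSimple.coe_gen]
        positivity
      · push_cast
        rw [IntermediateField.AdjoinSimple.coe_gen, pow_succ']
        nlinarith
      · intro w hw
        rw [hW.2 i]
        refine Set.mem_iUnion.2 ⟨k, Set.mem_iUnion₂.2 ⟨t, ht, _, h4 w hw, ?_⟩⟩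
        rw [starMap_add, starMap_gen_mul, pow_succ', ← add_assoc]
        exact congrArg (· + starMap e t) (map_add (QLin e) _ _)
    · obtain ⟨k, x, hx, h1, h2⟩ := hcov (y / lam) (by positivity) (by
        rw [div_lt_iff₀ hpos]
        calc y < lam ^ (n + 1) * ℓ j := hy
          _ = _ := by ring)
      rw [le_div_iff₀ hpos] at h1
      rw [div_lt_iff₀ hpos] at h2
      obtain ⟨i, t, ht, h3, h4⟩ := exists_mem_T_of_mem_Ico hsum (j := k) (x := y - lam * x)
        (by linarith) (by linarith)
      refine ⟨i, gen lam * x + t, ?_, ?_, ?_⟩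
      · exact Finset.mem_biUnion.2 ⟨k, Finset.mem_univ k, Finset.mem_image₂.2 ⟨t, ht, x, hx, rfl⟩⟩
      · push_cast
        rw [IntermediateField.AdjoinSimple.coe_gen]
        linarith
      · push_cast
        rw [IntermediateField.AdjoinSimple.coe_gen]
        linarith

end Tilings

/-! ### Positive volume of the windows by packing -/

section Volume

variable {lam : ℝ} {r s : ℕ} (e : ConjEnum lam r s)

theorem abs_det_QLin (hlam : IsPVUnit lam) : |LinearMap.det (QLin e)| = lam⁻¹ := by
  rw [QLin, LinearMap.det_toLpLin, abs_det_Q e hlam]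

theorem QLin_pow_injective (hlam : IsPVUnit lam) (m : ℕ) : Function.Injective (QLin e ^ m) := by
  have h : LinearMap.det (QLin e ^ m) ≠ 0 := by
    rw [map_pow]
    refine pow_ne_zero _ fun h => ?_
    have h1 := abs_det_QLin e hlam
    rw [h, abs_zero] at h1
    exact (inv_pos.2 (one_pos.trans hlam.one_lt)).ne h1
  exact (LinearMap.equivOfDetNeZero _ h).injective

theorem continuous_QLin_pow_add (m : ℕ) (c : Internal r s) :
    Continuous fun z => (QLin e ^ m) z + c :=
  (LinearMap.continuous_of_finiteDimensional (QLin e ^ m)).add continuous_const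

theorem volume_image_QLin_pow_add (hlam : IsPVUnit lam) (m : ℕ) (c : Internal r s)
    (S : Set (Internal r s)) :
    volume ((fun z => (QLin e ^ m) z + c) '' S) = ENNReal.ofReal (lam⁻¹ ^ m) * volume S := by
  have h : (fun z => (QLin e ^ m) z + c) '' S = (fun z => z + c) '' ((QLin e ^ m) '' S) := by
    rw [Set.image_image]
  rw [h, Set.image_add_right, measure_preimage_add_right, Measure.addHaar_image_linearMap,
    map_pow, abs_pow, abs_det_QLin e hlam]

/-- A packing bound: finitely many integers of `ℚ(lam)` in `[0, L]` whose conjugates carry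
translated and contracted copies of a ball inside `K`. -/
theorem card_mul_volume_ball_le (hlam : IsPVUnit lam) {F : Finset (Fld lam)}
    (hint : ∀ x ∈ F, IsIntegral ℤ x) {L : ℝ} (hL : ∀ x ∈ F, 0 ≤ (x : ℝ) ∧ (x : ℝ) ≤ L) (m : ℕ)
    (w : Internal r s) {K : Set (Internal r s)}
    (hK : ∀ x ∈ F, ∀ z ∈ Metric.ball w (1 / 2), (QLin e ^ m) z + starMap e x ∈ K) :
    F.card * volume (Metric.ball w (1 / 2)) ≤ ENNReal.ofReal (L + lam ^ m) * volume K := by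
  have hpos : 0 < lam := one_pos.trans hlam.one_lt
  -- The length λᵐ compensates the factor λ⁻ᵐ from Qᵐ, so every box has the volume of the ball.
  let box (x : Fld lam) : Set (ℝ × Internal r s) :=
    Set.Ico (x : ℝ) (x + lam ^ m) ×ˢ ((fun z => (QLin e ^ m) z + starMap e x) '' Metric.ball w (1 / 2))
  have hvol (x : Fld lam) : volume (box x) = volume (Metric.ball w (1 / 2)) := by
    rw [Measure.volume_eq_prod, Measure.prod_prod, volume_image_QLin_pow_add e hlam, Real.volume_Ico,
      add_sub_cancel_left, ← mul_assoc, ← ENNReal.ofReal_mul (by positivity), ← mul_pow,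
      mul_inv_cancel₀ hpos.ne', one_pow, ENNReal.ofReal_one, one_mul]
  have hmeas (x : Fld lam) : MeasurableSet (box x) := by
    refine measurableSet_Ico.prod ?_
    refine measurableSet_ball.image_of_continuousOn_injOn
      (continuous_QLin_pow_add e m _).continuousOn fun a _ b _ hab => ?_
    exact QLin_pow_injective e hlam m (add_right_cancel hab)
  have hdisj : Set.PairwiseDisjoint (F : Set (Fld lam)) box := by
    intro x hx y hy hxy
    refine Set.disjoint_left.2 ?_
    rintro ⟨a, b⟩ ⟨⟨h1, h2⟩, z, hz, h3⟩ ⟨⟨h4, h5⟩, z', hz', h6⟩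
    apply hxy
    simp only at h1 h2 h3 h4 h5 h6
    have hgen := hlam.gen_ne_zero
    -- If two boxes meet, λ⁻ᵐ(x − y) is an integer, as λ is a unit. Its absolute value is below 1,
    -- and its star image z' − z has norm below 1 because the ball has radius 1/2.
    have hd : (gen lam)⁻¹ ^ m * (x - y) = 0 := by
      refine eq_zero_of_abs_lt_one e hlam
        ((hlam.gen_inv_isIntegral.pow m).mul ((hint x hx).sub (hint y hy))) ?_ ?_
      · push_cast
        rw [IntermediateField.AdjoinSimple.coe_gen, abs_mul, abs_pow, abs_inv, abs_of_pos hpos,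
          inv_pow, ← div_eq_inv_mul, div_lt_one (by positivity), abs_lt]
        constructor <;> linarith
      · have h7 : (QLin e ^ m) (starMap e ((gen lam)⁻¹ ^ m * (x - y))) = (QLin e ^ m) (z' - z) := by
          rw [← starMap_gen_pow_mul, ← mul_assoc, ← mul_pow, mul_inv_cancel₀ hgen, one_pow, one_mul,
            starMap_sub, map_sub, sub_eq_sub_iff_add_eq_add, add_comm, h3, ← h6]
        rw [QLin_pow_injective e hlam m h7, ← dist_eq_norm]
        rw [Metric.mem_ball] at hz hz'
        have := dist_triangle_right z' z w
        linarith
    exact sub_eq_zero.1 ((mul_eq_zero.1 hd).resolve_left (pow_ne_zero _ (inv_ne_zero hgen)))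
  have hsub : (⋃ x ∈ F, box x) ⊆ Set.Ico 0 (L + lam ^ m) ×ˢ K := by
    refine Set.iUnion₂_subset fun x hx => ?_
    obtain ⟨h1, h2⟩ := hL x hx
    refine Set.prod_mono (Set.Ico_subset_Ico h1 (by linarith)) ?_
    rintro _ ⟨z, hz, rfl⟩
    exact hK x hx z hz
  calc F.card * volume (Metric.ball w (1 / 2)) = ∑ x ∈ F, volume (box x) := by
        simp only [hvol, Finset.sum_const, nsmul_eq_mul]
    _ = volume (⋃ x ∈ F, box x) := (measure_biUnion_finset hdisj fun x _ => hmeas x).symm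
    _ ≤ volume (Set.Ico 0 (L + lam ^ m) ×ˢ K) := measure_mono hsub
    _ = _ := by
      rw [Measure.volume_eq_prod, Measure.prod_prod, Real.volume_Ico, sub_zero]

variable {A : Type*} [Fintype A] [DecidableEq A] {ϱ : A → List A} {ℓ : A → Fld lam}

/-- Tiles of a level-m supertile have total length at least λᵐℓ_j, while packing bounds the number
of each type. Balls are centred at a point of W_j, so their images under Qᵐ + x⋆ stay within ρᵐ of
W_i. The factor λᵐ cancels. -/
theorem le_sum_volume_cthickening (hlam : IsPVUnit lam) (hℓint : ∀ i, IsIntegral ℤ (ℓ i))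
    (hℓ : ∀ i, 0 < (ℓ i : ℝ)) (hsum : ∀ j, (((ϱ j).map ℓ).sum : ℝ) = lam * ℓ j)
    {W : A → Set (Internal r s)} (hW : IsWindowFamily e ϱ ℓ W) {ρ : ℝ} (hρ : 0 ≤ ρ)
    (hQ : ∀ x, ‖QLin e x‖ ≤ ρ * ‖x‖) (j : A) (m : ℕ) :
    ENNReal.ofReal (ℓ j) * volume (Metric.ball (0 : Internal r s) (1 / 2)) ≤
      ENNReal.ofReal (ℓ j + 1) *
        ∑ i, ENNReal.ofReal (ℓ i) * volume (Metric.cthickening (ρ ^ m) (W i)) := by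
  have hpos : 0 < lam := one_pos.trans hlam.one_lt
  obtain ⟨F, hF, hcov⟩ := exists_level_tiles e hlam hℓint hℓ hsum hW j m
  obtain ⟨w, hw⟩ := (hW.1 j).2
  have hcard (i : A) : (F i).card * volume (Metric.ball w (1 / 2)) ≤
      ENNReal.ofReal (lam ^ m * ℓ j + lam ^ m) * volume (Metric.cthickening (ρ ^ m) (W i)) := by
    refine card_mul_volume_ball_le e hlam (fun x hx => (hF i x hx).1)
      (fun x hx => ⟨(hF i x hx).2.1, by linarith [(hF i x hx).2.2.1, hℓ i]⟩) m w ?_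
    intro x hx z hz
    refine Metric.mem_cthickening_of_dist_le _ _ _ _ ((hF i x hx).2.2.2 w hw) ?_
    rw [dist_add_right, dist_eq_norm, ← map_sub]
    refine (norm_QLin_pow_le e hρ hQ m _).trans ?_
    rw [Metric.mem_ball, dist_eq_norm] at hz
    exact mul_le_of_le_one_right (pow_nonneg hρ m) (by linarith)
  have hlen := le_sum_card_mul_of_cover (fun i => (hℓ i).le) F hcov
  have hlen' : ENNReal.ofReal (lam ^ m) * ENNReal.ofReal (ℓ j) ≤
      ∑ i, (F i).card * ENNReal.ofReal (ℓ i) := by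
    rw [← ENNReal.ofReal_mul (by positivity)]
    refine (ENNReal.ofReal_le_ofReal hlen).trans_eq ?_
    rw [ENNReal.ofReal_sum_of_nonneg fun i _ => mul_nonneg (Nat.cast_nonneg _) (hℓ i).le]
    exact Finset.sum_congr rfl fun i _ => by
      rw [ENNReal.ofReal_mul (Nat.cast_nonneg _), ENNReal.ofReal_natCast]
  have hball : volume (Metric.ball w (1 / 2)) = volume (Metric.ball (0 : Internal r s) (1 / 2)) :=
    Measure.addHaar_ball_center _ _ _
  rw [hball] at hcard
  set b := volume (Metric.ball (0 : Internal r s) (1 / 2))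
  have hm : ENNReal.ofReal (lam ^ m) ≠ 0 := by simpa using pow_pos hpos m
  refine (ENNReal.mul_le_mul_iff_right hm ENNReal.ofReal_ne_top).1 ?_
  calc ENNReal.ofReal (lam ^ m) * (ENNReal.ofReal (ℓ j) * b)
      = ENNReal.ofReal (lam ^ m) * ENNReal.ofReal (ℓ j) * b := by ring
    _ ≤ (∑ i, (F i).card * ENNReal.ofReal (ℓ i)) * b := by gcongr
    _ = ∑ i, ENNReal.ofReal (ℓ i) * ((F i).card * b) := by
      rw [Finset.sum_mul]
      exact Finset.sum_congr rfl fun i _ => by ring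
    _ ≤ ∑ i, ENNReal.ofReal (ℓ i) * (ENNReal.ofReal (lam ^ m * ℓ j + lam ^ m) *
          volume (Metric.cthickening (ρ ^ m) (W i))) := by
      exact Finset.sum_le_sum fun i _ => mul_le_mul' le_rfl (hcard i)
    _ = _ := by
      rw [← mul_assoc, ← ENNReal.ofReal_mul (by positivity), Finset.mul_sum, mul_add_one]
      exact Finset.sum_congr rfl fun i _ => by ring

/-- As m → ∞ the thickened volumes tend to those of the compact windows, while the lower bound stays
fixed and positive. -/
theorem exists_volume_window_pos [Nonempty A] (hlam : IsPVUnit lam) (hℓint : ∀ i, IsIntegral ℤ (ℓ i))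
    (hℓ : ∀ i, 0 < (ℓ i : ℝ)) (hsum : ∀ j, (((ϱ j).map ℓ).sum : ℝ) = lam * ℓ j)
    {W : A → Set (Internal r s)} (hW : IsWindowFamily e ϱ ℓ W) {ρ : ℝ} (hρ : 0 ≤ ρ) (hρ1 : ρ < 1)
    (hQ : ∀ x, ‖QLin e x‖ ≤ ρ * ‖x‖) : ∃ i, volume (W i) ≠ 0 := by
  by_contra! h0
  obtain ⟨j⟩ := ‹Nonempty A›
  have hlim (i : A) : Tendsto (fun m : ℕ => ENNReal.ofReal (ℓ i) *
      volume (Metric.cthickening (ρ ^ m) (W i))) atTop (𝓝 0) := by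
    have h1 := (tendsto_measure_cthickening_of_isCompact (μ := volume) (hW.1 i).1).comp
      (tendsto_pow_atTop_nhds_zero_of_lt_one hρ hρ1)
    rw [h0 i] at h1
    simpa using ENNReal.Tendsto.const_mul h1 (Or.inr ENNReal.ofReal_ne_top)
  have h2 := tendsto_finsetSum Finset.univ fun i _ => hlim i
  have h3 := ENNReal.Tendsto.const_mul (a := ENNReal.ofReal (ℓ j + 1)) h2
    (Or.inr ENNReal.ofReal_ne_top)
  rw [Finset.sum_const_zero, mul_zero] at h3
  have h4 := ge_of_tendsto' h3 (le_sum_volume_cthickening e hlam hℓint hℓ hsum hW hρ hQ j)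
  have h5 : volume (Metric.ball (0 : Internal r s) (1 / 2)) ≠ 0 :=
    (Metric.measure_ball_pos volume _ (by norm_num)).ne'
  have h6 : ENNReal.ofReal (ℓ j) ≠ 0 := by simpa using hℓ j
  exact mul_ne_zero h6 h5 (le_antisymm h4 bot_le)

end Volume

/-! ### Fourier transforms of windows and the renormalisation equation -/

section FourierTransformOfWindows

/-- The restriction to the union is dominated by the sum of the restrictions; equal finite total
mass makes the two measures equal. Disjointness is replaced by additivity of volume. -/
theorem setIntegral_iUnion_of_measure_eq_sum {X E ι : Type*} [MeasurableSpace X]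
    [NormedAddCommGroup E] [NormedSpace ℝ E] [Fintype ι] {μ : Measure X} {s : ι → Set X}
    (hfin : μ (⋃ i, s i) ≠ ⊤) (h : μ (⋃ i, s i) = ∑ i, μ (s i)) {f : X → E}
    (hf : ∀ i, IntegrableOn f (s i) μ) :
    ∫ x in ⋃ i, s i, f x ∂μ = ∑ i, ∫ x in s i, f x ∂μ := by
  have : IsFiniteMeasure (μ.restrict (⋃ i, s i)) := ⟨by
    rw [Measure.restrict_apply_univ]; exact hfin.lt_top⟩
  have hle := Measure.restrict_iUnion_le (μ := μ) (s := s)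
  have heq := Measure.eq_of_le_of_measure_univ_eq hle (by
    rw [Measure.sum_fintype, Measure.finsetSum_apply]
    simpa using h)
  rw [heq, Measure.sum_fintype, integral_finsetSum_measure fun i _ => hf i]

variable {lam : ℝ} {r s : ℕ}

theorem indicatorFT_eq {K : Set (Internal r s)} (hK : MeasurableSet K) (y : Internal r s) :
    indicatorFT K y = ∫ x in K, Complex.exp (2 * Real.pi * Complex.I * (inner ℝ x y : ℝ)) := by
  rw [indicatorFT, Real.fourierInv_eq', ← integral_indicator hK]
  refine integral_congr_ae (Eventually.of_forall fun x => ?_)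
  by_cases hx : x ∈ K
  · simp only [hx, Set.indicator_of_mem, smul_eq_mul, mul_one]
    congr 1
    push_cast
    ring
  · simp [hx]

theorem norm_exp_two_pi_I_mul (a : ℝ) : ‖Complex.exp (2 * Real.pi * Complex.I * a)‖ = 1 := by
  have : (2 * Real.pi * Complex.I * a : ℂ) = ((2 * Real.pi * a : ℝ) : ℂ) * Complex.I := by
    push_cast; ring
  rw [this, Complex.norm_exp_ofReal_mul_I]

theorem continuous_indicatorFT {K : Set (Internal r s)} (hK : IsCompact K) :
    Continuous (indicatorFT K) := by
  have h : indicatorFT K = fun y =>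
      ∫ x in K, Complex.exp (2 * Real.pi * Complex.I * (inner ℝ x y : ℝ)) :=
    funext (indicatorFT_eq hK.measurableSet)
  rw [h]
  refine continuous_of_dominated (bound := fun _ => 1) (fun y => ?_) (fun y => ?_) ?_ ?_
  · exact Continuous.aestronglyMeasurable (by fun_prop)
  · exact Eventually.of_forall fun x => (norm_exp_two_pi_I_mul _).le
  · exact (integrableOn_const (μ := volume) (C := (1 : ℝ)) hK.measure_ne_top)
  · exact Eventually.of_forall fun x => by fun_prop

theorem indicatorFT_zero {K : Set (Internal r s)} (hK : MeasurableSet K) :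
    indicatorFT K 0 = ((volume K).toReal : ℂ) := by
  rw [indicatorFT_eq hK]
  simp [Measure.real]

variable (e : ConjEnum lam r s)

/-- Change of variables: the Jacobian gives λ⁻¹, the translation gives the phase, and moving Q
across the inner product gives R. -/
theorem setIntegral_image_affineQ (hlam : IsPVUnit lam) {K : Set (Internal r s)}
    (hK : MeasurableSet K) (t : Fld lam) (y : Internal r s) :
    ∫ x in affineQ e t '' K, Complex.exp (2 * Real.pi * Complex.I * (inner ℝ x y : ℝ)) =
      (lam⁻¹ : ℂ) * Complex.exp (2 * Real.pi * Complex.I * (inner ℝ (starMap e t) y : ℝ)) *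
        indicatorFT K (RLin e y) := by
  have hd (x : Internal r s) : HasFDerivWithinAt (affineQ e t)
      (LinearMap.toContinuousLinearMap (QLin e)) K x :=
    ((LinearMap.toContinuousLinearMap (QLin e)).hasFDerivAt.add_const _).hasFDerivWithinAt
  have hinj : Set.InjOn (affineQ e t) K := fun a _ b _ hab => by
    have := QLin_pow_injective e hlam 1
    rw [pow_one] at this
    exact this (add_right_cancel hab)
  rw [integral_image_eq_integral_abs_det_fderiv_smul volume hK (fun x _ => hd x) hinj,
    indicatorFT_eq hK, ← integral_const_mul]
  refine integral_congr_ae (Eventually.of_forall fun x => ?_)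
  have hdet : |(LinearMap.toContinuousLinearMap (QLin e)).det| = lam⁻¹ := abs_det_QLin e hlam
  simp only
  rw [hdet, Complex.real_smul, Complex.ofReal_inv, mul_assoc (lam⁻¹ : ℂ), ← Complex.exp_add,
    affineQ, inner_add_left, inner_QLin]
  congr 2
  push_cast
  ring

variable {A : Type*} [DecidableEq A] {ϱ : A → List A} {ℓ : A → Fld lam}

theorem window_eq_iUnion_sigma {W : A → Set (Internal r s)}
    (hW : IsWindowFamily e ϱ ℓ W) (i : A) :
    W i = ⋃ p : (j : A) × {t // t ∈ T ϱ ℓ i j}, affineQ e p.2.1 '' W p.1 := by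
  conv_lhs => rw [hW.2 i]
  rw [Set.iUnion_sigma]
  exact Set.iUnion_congr fun j => (Set.iUnion_subtype (fun t => t ∈ T ϱ ℓ i j)
    fun t => affineQ e t.1 '' W j).symm

variable [Fintype A]

/-- The substitution matrix, scaled to have spectral radius `1`. -/
noncomputable abbrev scaledMatrix (lam : ℝ) (ϱ : A → List A) : Matrix A A ℝ :=
  lam⁻¹ • substMatrix ϱ

theorem scaledMatrix_apply (hℓ : ∀ i, 0 < (ℓ i : ℝ))
    (hsum : ∀ j, (((ϱ j).map ℓ).sum : ℝ) = lam * ℓ j) (i j : A) :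
    scaledMatrix lam ϱ i j = lam⁻¹ * (T ϱ ℓ i j).card := by
  rw [card_T hℓ hsum]
  rfl

theorem sum_volume_pieces (hlam : IsPVUnit lam) (hℓ : ∀ i, 0 < (ℓ i : ℝ))
    (hsum : ∀ j, (((ϱ j).map ℓ).sum : ℝ) = lam * ℓ j) {W : A → Set (Internal r s)}
    (hW : IsWindowFamily e ϱ ℓ W) (i : A) :
    ∑ p : (j : A) × {t // t ∈ T ϱ ℓ i j}, volume (affineQ e p.2.1 '' W p.1) =
      ENNReal.ofReal ((scaledMatrix lam ϱ *ᵥ fun j => (volume (W j)).toReal) i) := by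
  have hpos : 0 < lam := one_pos.trans hlam.one_lt
  have hvol (t : Fld lam) (j : A) : volume (affineQ e t '' W j) =
      ENNReal.ofReal lam⁻¹ * volume (W j) := by
    simpa using volume_image_QLin_pow_add e hlam 1 (starMap e t) (W j)
  simp only [hvol]
  rw [Fintype.sum_sigma, Matrix.mulVec, dotProduct, ENNReal.ofReal_sum_of_nonneg]
  · refine Finset.sum_congr rfl fun j _ => ?_
    rw [scaledMatrix_apply hℓ hsum, ENNReal.ofReal_mul (by positivity), ENNReal.ofReal_mul (by positivity),
      ENNReal.ofReal_natCast, ENNReal.ofReal_toReal (hW.1 j).1.measure_ne_top]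
    simp
    ring
  · intro j _
    rw [scaledMatrix_apply hℓ hsum]
    positivity

/-- Only subadditivity is available here, since the pieces may overlap a priori. -/
theorem volume_window_le (hlam : IsPVUnit lam) (hℓ : ∀ i, 0 < (ℓ i : ℝ))
    (hsum : ∀ j, (((ϱ j).map ℓ).sum : ℝ) = lam * ℓ j) {W : A → Set (Internal r s)}
    (hW : IsWindowFamily e ϱ ℓ W) (i : A) :
    (volume (W i)).toReal ≤ (scaledMatrix lam ϱ *ᵥ fun j => (volume (W j)).toReal) i := by
  have hpos : 0 < lam := one_pos.trans hlam.one_lt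
  refine ENNReal.toReal_le_of_le_ofReal ?_ ?_
  · refine Finset.sum_nonneg fun j _ => mul_nonneg ?_ ENNReal.toReal_nonneg
    exact (by positivity : (0 : ℝ) ≤ lam⁻¹ * (T ϱ ℓ i j).card).trans_eq
      (scaledMatrix_apply hℓ hsum i j).symm
  · rw [← sum_volume_pieces e hlam hℓ hsum hW]
    conv_lhs => rw [window_eq_iUnion_sigma e hW i]
    exact measure_iUnion_fintype_le _ _

/-- The renormalisation equation for the Fourier transforms of the windows. -/
theorem indicatorFT_window (hlam : IsPVUnit lam) (hℓ : ∀ i, 0 < (ℓ i : ℝ))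
    (hsum : ∀ j, (((ϱ j).map ℓ).sum : ℝ) = lam * ℓ j) {W : A → Set (Internal r s)}
    (hW : IsWindowFamily e ϱ ℓ W)
    (hvol : (scaledMatrix lam ϱ *ᵥ fun j => (volume (W j)).toReal) =
      fun j => (volume (W j)).toReal) (y : Internal r s) :
    (fun i => indicatorFT (W i) y) =
      (lam⁻¹ : ℂ) • (B e ϱ ℓ y *ᵥ fun i => indicatorFT (W i) (RLin e y)) := by
  funext i
  have hmeas (j : A) : MeasurableSet (W j) := (hW.1 j).1.measurableSet
  have hU := window_eq_iUnion_sigma e hW i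
  rw [indicatorFT_eq (hmeas i)]
  conv_lhs => rw [hU]
  rw [setIntegral_iUnion_of_measure_eq_sum]
  · simp only [setIntegral_image_affineQ e hlam (hmeas _)]
    rw [Fintype.sum_sigma, Pi.smul_apply, Matrix.mulVec, dotProduct, Finset.smul_sum]
    refine Finset.sum_congr rfl fun j _ => ?_
    rw [B, Matrix.of_apply, smul_eq_mul, Finset.sum_mul, Finset.mul_sum,
      ← Finset.sum_coe_sort (T ϱ ℓ i j)]
    exact Finset.sum_congr rfl fun t _ => mul_assoc _ _ _
  · rw [← hU]
    exact (hW.1 i).1.measure_ne_top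
  · rw [← hU, sum_volume_pieces e hlam hℓ hsum hW, hvol,
      ENNReal.ofReal_toReal (hW.1 i).1.measure_ne_top]
  · intro p
    refine ContinuousOn.integrableOn_compact ((hW.1 p.1).1.image (continuous_affineQ e _)) ?_
    exact Continuous.continuousOn (by fun_prop)

end FourierTransformOfWindows

/-! ### Convergence of the scaled cocycle -/

section Cocycle

variable {A : Type*} [DecidableEq A] {lam : ℝ} {r s : ℕ} (e : ConjEnum lam r s)
  (ϱ : A → List A) (ℓ : A → Fld lam)

theorem continuous_B : Continuous (B e ϱ ℓ) := by
  refine continuous_matrix fun i j => ?_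
  simp only [B, Matrix.of_apply]
  fun_prop

theorem norm_B_le (i j : A) (y : Internal r s) : ‖B e ϱ ℓ y i j‖ ≤ substMatrix ϱ i j := by
  rw [B, Matrix.of_apply]
  refine (norm_sum_le _ _).trans ?_
  simp only [norm_exp_two_pi_I_mul, Finset.sum_const, nsmul_eq_mul, mul_one]
  exact card_T_le i j

variable [Fintype A]

theorem continuous_cocycle (n : ℕ) : Continuous (cocycle e ϱ ℓ n) := by
  induction n with
  | zero => exact continuous_const
  | succ n ih =>
    exact ih.matrix_mul ((continuous_B e ϱ ℓ).comp (LinearMap.continuous_of_finiteDimensional _))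

theorem continuous_scaledCocycle (n : ℕ) : Continuous (scaledCocycle e ϱ ℓ n) := by
  exact (continuous_cocycle e ϱ ℓ n).const_smul ((|(R e).det| ^ n : ℝ) : ℂ)

theorem cocycle_add (n m : ℕ) (y : Internal r s) : cocycle e ϱ ℓ (n + m) y =
    cocycle e ϱ ℓ n y * cocycle e ϱ ℓ m ((RLin e ^ n) y) := by
  induction m with
  | zero => simp [cocycle]
  | succ m ih =>
    rw [← add_assoc, cocycle, ih, cocycle, mul_assoc, toEuclideanLin_R_pow, toEuclideanLin_R_pow,
      add_comm n m, pow_add]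
    rfl

theorem scaledCocycle_add (n m : ℕ) (y : Internal r s) : scaledCocycle e ϱ ℓ (n + m) y =
    scaledCocycle e ϱ ℓ n y * scaledCocycle e ϱ ℓ m ((RLin e ^ n) y) := by
  rw [scaledCocycle, scaledCocycle, scaledCocycle, cocycle_add, smul_mul_smul_comm, pow_add,
    Complex.ofReal_mul]

variable {ϱ ℓ}

theorem abs_det_R (hlam : IsPVUnit lam) : |(R e).det| = lam⁻¹ := by
  rw [R, Matrix.det_transpose, abs_det_Q e hlam]

theorem B_zero (hℓ : ∀ i, 0 < (ℓ i : ℝ)) (hsum : ∀ j, (((ϱ j).map ℓ).sum : ℝ) = lam * ℓ j) :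
    B e ϱ ℓ 0 = (substMatrix ϱ).map Complex.ofReal := by
  ext i j
  simp [B, ← card_T hℓ hsum i j]

theorem scaledCocycle_zero (hlam : IsPVUnit lam) (hℓ : ∀ i, 0 < (ℓ i : ℝ))
    (hsum : ∀ j, (((ϱ j).map ℓ).sum : ℝ) = lam * ℓ j) (n : ℕ) :
    scaledCocycle e ϱ ℓ n 0 = (scaledMatrix lam ϱ ^ n).map Complex.ofReal := by
  have h (n : ℕ) : cocycle e ϱ ℓ n 0 = (substMatrix ϱ ^ n).map Complex.ofReal := by
    induction n with
    | zero => simp [cocycle, Matrix.map_one]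
    | succ n ih =>
      rw [cocycle, ih, map_zero, B_zero e hℓ hsum, pow_succ]
      exact (Matrix.map_mul (f := Complex.ofRealHom)).symm
  rw [scaledCocycle, h, abs_det_R e hlam, smul_pow]
  ext i j
  simp

theorem norm_scaledCocycle_le (hlam : IsPVUnit lam) (n : ℕ) (y : Internal r s) (i j : A) :
    ‖scaledCocycle e ϱ ℓ n y i j‖ ≤ (scaledMatrix lam ϱ ^ n) i j := by
  have hpos : 0 < lam := one_pos.trans hlam.one_lt
  have h (n : ℕ) : ∀ i j, ‖cocycle e ϱ ℓ n y i j‖ ≤ (substMatrix ϱ ^ n) i j := by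
    induction n with
    | zero =>
      intro i j
      by_cases hij : i = j <;> simp [cocycle, hij, Matrix.one_apply]
    | succ n ih =>
      intro i j
      rw [cocycle, pow_succ, Matrix.mul_apply, Matrix.mul_apply]
      refine (norm_sum_le _ _).trans (Finset.sum_le_sum fun k _ => ?_)
      rw [norm_mul]
      exact mul_le_mul (ih i k) (norm_B_le e ϱ ℓ k j _) (norm_nonneg _) ((norm_nonneg _).trans (ih i k))
  rw [scaledCocycle, abs_det_R e hlam, smul_pow, Matrix.smul_apply, Matrix.smul_apply, norm_smul,
    Complex.norm_real, Real.norm_eq_abs, abs_of_nonneg (by positivity), smul_eq_mul]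
  exact mul_le_mul_of_nonneg_left (h n i j) (by positivity)

/-- The scaled cocycle is uniformly bounded, as its entries are dominated by convergent powers. -/
theorem exists_norm_scaledCocycle_mulVec_le (hlam : IsPVUnit lam) {P : Matrix A A ℝ}
    (hP : Tendsto (fun n => scaledMatrix lam ϱ ^ n) atTop (𝓝 P)) :
    ∃ K : ℝ, 0 < K ∧ ∀ n y (z : A → ℂ), ‖scaledCocycle e ϱ ℓ n y *ᵥ z‖ ≤ K * ‖z‖ := by
  have hbdd (i j : A) : ∃ c : ℝ, ∀ n, (scaledMatrix lam ϱ ^ n) i j ≤ c := by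
    have h : Tendsto (fun n => (scaledMatrix lam ϱ ^ n) i j) atTop (𝓝 (P i j)) :=
      ((continuous_id.matrix_elem i j).tendsto P).comp hP
    obtain ⟨c, hc⟩ := h.bddAbove_range
    exact ⟨c, fun n => hc ⟨n, rfl⟩⟩
  choose c hc using hbdd
  have hc0 (i j : A) : 0 ≤ c i j :=
    (norm_nonneg _).trans ((norm_scaledCocycle_le e (ℓ := ℓ) hlam 0 0 i j).trans (hc i j 0))
  have hK : 0 ≤ ∑ i, ∑ j, c i j := Finset.sum_nonneg fun i _ => Finset.sum_nonneg fun j _ => hc0 i j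
  refine ⟨∑ i, ∑ j, c i j + 1, by linarith, fun n y z => ?_⟩
  have h1 : ‖scaledCocycle e ϱ ℓ n y *ᵥ z‖ ≤ (∑ i, ∑ j, c i j) * ‖z‖ := by
    refine (pi_norm_le_iff_of_nonneg (by positivity)).2 fun i => ?_
    calc ‖∑ j, scaledCocycle e ϱ ℓ n y i j * z j‖
        ≤ ∑ j, ‖scaledCocycle e ϱ ℓ n y i j * z j‖ := norm_sum_le _ _
      _ ≤ ∑ j, c i j * ‖z‖ := by
        refine Finset.sum_le_sum fun j _ => ?_
        rw [norm_mul]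
        exact mul_le_mul ((norm_scaledCocycle_le e hlam n y i j).trans (hc i j n))
          (norm_le_pi_norm z j) (norm_nonneg _) (hc0 i j)
      _ = (∑ j, c i j) * ‖z‖ := (Finset.sum_mul _ _ _).symm
      _ ≤ (∑ i, ∑ j, c i j) * ‖z‖ := by
        refine mul_le_mul_of_nonneg_right ?_ (norm_nonneg _)
        exact Finset.single_le_sum (f := fun i => ∑ j, c i j)
          (fun i _ => Finset.sum_nonneg fun j _ => hc0 i j) (Finset.mem_univ i)
  nlinarith [norm_nonneg z]

/-- In S_{k+m}(y)x = S_k(y)S_m(Rᵏy)x the inner vector is close to ⟨u|x⟩v, and S_k(y) is bounded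
uniformly in k. Convergence on v alone thus gives convergence on every x. -/
theorem tendsto_scaledCocycle_mulVec (hlam : IsPVUnit lam) (hℓ : ∀ i, 0 < (ℓ i : ℝ))
    (hsum : ∀ j, (((ϱ j).map ℓ).sum : ℝ) = lam * ℓ j) {u v : A → ℝ}
    (hP : Tendsto (fun n => scaledMatrix lam ϱ ^ n) atTop (𝓝 (Matrix.vecMulVec v u)))
    (hR : ∀ y, Tendsto (fun n => (RLin e ^ n) y) atTop (𝓝 0)) {y : Internal r s} {c : A → ℂ}
    (hc : Tendsto (fun n => scaledCocycle e ϱ ℓ n y *ᵥ fun i => (v i : ℂ)) atTop (𝓝 c))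
    (x : A → ℂ) :
    Tendsto (fun n => scaledCocycle e ϱ ℓ n y *ᵥ x) atTop
      (𝓝 (((fun i => (u i : ℂ)) ⬝ᵥ x) • c)) := by
  set a : ℂ := (fun i => (u i : ℂ)) ⬝ᵥ x with ha
  set vC : A → ℂ := fun i => (v i : ℂ) with hvC
  obtain ⟨K, hK, hbound⟩ := exists_norm_scaledCocycle_mulVec_le e (ℓ := ℓ) hlam hP
  have hPC : Tendsto (fun m => scaledCocycle e ϱ ℓ m 0 *ᵥ x) atTop (𝓝 (a • vC)) := by
    have h1 : Continuous fun N : Matrix A A ℝ => N.map Complex.ofReal *ᵥ x :=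
      (continuous_id.matrix_map Complex.continuous_ofReal).matrix_mulVec continuous_const
    have h2 := (h1.tendsto _).comp hP
    have h3 : (Matrix.vecMulVec v u).map Complex.ofReal *ᵥ x = a • vC := by
      have : (Matrix.vecMulVec v u).map Complex.ofReal =
          Matrix.vecMulVec vC (fun i => (u i : ℂ)) := by
        ext i j; simp [Matrix.vecMulVec_apply, hvC]
      rw [this, Matrix.vecMulVec_mulVec, op_smul_eq_smul]
    rw [h3] at h2
    refine h2.congr fun m => ?_
    rw [scaledCocycle_zero e hlam hℓ hsum]
    rfl
  rw [Metric.tendsto_atTop]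
  intro ε hε
  -- First m is fixed by Perron–Frobenius at y = 0; then k grows, using continuity of S_m at 0.
  obtain ⟨m, hm⟩ := ((Metric.tendsto_nhds.1 hPC) (ε / (2 * K)) (by positivity)).exists
  have h1 : Tendsto (fun n => scaledCocycle e ϱ ℓ m ((RLin e ^ n) y) *ᵥ x) atTop
      (𝓝 (scaledCocycle e ϱ ℓ m 0 *ᵥ x)) :=
    ((((continuous_scaledCocycle e ϱ ℓ m).matrix_mulVec continuous_const).tendsto 0).comp (hR y))
  have h2 := (h1.dist (tendsto_const_nhds (x := a • vC))).eventually (gt_mem_nhds hm)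
  have h3 := (Metric.tendsto_nhds.1 (hc.const_smul a)) (ε / 2) (by positivity)
  obtain ⟨N, hN⟩ := eventually_atTop.1 (h2.and h3)
  refine ⟨N + m, fun n hn => ?_⟩
  obtain ⟨k, rfl⟩ := Nat.exists_eq_add_of_le' ((Nat.le_add_left m N).trans hn)
  obtain ⟨h4, h5⟩ := hN k (by omega)
  have h6 : dist (scaledCocycle e ϱ ℓ (k + m) y *ᵥ x) (a • (scaledCocycle e ϱ ℓ k y *ᵥ vC)) ≤
      K * dist (scaledCocycle e ϱ ℓ m ((RLin e ^ k) y) *ᵥ x) (a • vC) := by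
    rw [dist_eq_norm, dist_eq_norm, scaledCocycle_add, ← Matrix.mulVec_mulVec,
      ← Matrix.mulVec_smul, ← Matrix.mulVec_sub]
    exact hbound _ _ _
  have h7 : K * dist (scaledCocycle e ϱ ℓ m ((RLin e ^ k) y) *ᵥ x) (a • vC) < ε / 2 := by
    calc _ < K * (ε / (2 * K)) := mul_lt_mul_of_pos_left h4 hK
      _ = ε / 2 := by field_simp
  exact (dist_triangle _ _ _).trans_lt (by linarith)

theorem tendsto_scaledCocycle (hlam : IsPVUnit lam) (hℓ : ∀ i, 0 < (ℓ i : ℝ))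
    (hsum : ∀ j, (((ϱ j).map ℓ).sum : ℝ) = lam * ℓ j) {u v : A → ℝ}
    (hP : Tendsto (fun n => scaledMatrix lam ϱ ^ n) atTop (𝓝 (Matrix.vecMulVec v u)))
    (hR : ∀ y, Tendsto (fun n => (RLin e ^ n) y) atTop (𝓝 0)) {y : Internal r s} {c : A → ℂ}
    (hc : Tendsto (fun n => scaledCocycle e ϱ ℓ n y *ᵥ fun i => (v i : ℂ)) atTop (𝓝 c)) :
    Tendsto (fun n => scaledCocycle e ϱ ℓ n y) atTop
      (𝓝 (Matrix.vecMulVec c fun i => (u i : ℂ))) := by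
  refine tendsto_matrix fun i j => ?_
  have h := tendsto_pi_nhds.1
    (tendsto_scaledCocycle_mulVec e hlam hℓ hsum hP hR hc (Pi.single j 1)) i
  simpa [Matrix.vecMulVec_apply, mul_comm] using h

/-- Since f(y) = S_n(y)f(Rⁿy) for every n, uniform boundedness of S_n allows f(Rⁿy) to be replaced
by its limit f(0). -/
theorem tendsto_scaledCocycle_mulVec_window (hlam : IsPVUnit lam) (hℓ : ∀ i, 0 < (ℓ i : ℝ))
    (hsum : ∀ j, (((ϱ j).map ℓ).sum : ℝ) = lam * ℓ j) {P : Matrix A A ℝ}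
    (hP : Tendsto (fun n => scaledMatrix lam ϱ ^ n) atTop (𝓝 P))
    (hR : ∀ y, Tendsto (fun n => (RLin e ^ n) y) atTop (𝓝 0)) {W : A → Set (Internal r s)}
    (hW : IsWindowFamily e ϱ ℓ W)
    (hvol : (scaledMatrix lam ϱ *ᵥ fun j => (volume (W j)).toReal) =
      fun j => (volume (W j)).toReal) (y : Internal r s) :
    Tendsto (fun n => scaledCocycle e ϱ ℓ n y *ᵥ fun i => ((volume (W i)).toReal : ℂ)) atTop
      (𝓝 fun i => indicatorFT (W i) y) := by
  obtain ⟨K, -, hbound⟩ := exists_norm_scaledCocycle_mulVec_le e (ℓ := ℓ) hlam hP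
  have hrec (n : ℕ) : scaledCocycle e ϱ ℓ n y *ᵥ (fun i => indicatorFT (W i) ((RLin e ^ n) y)) =
      fun i => indicatorFT (W i) y := by
    induction n with
    | zero => simp [scaledCocycle, cocycle]
    | succ n ih =>
      rw [← ih, indicatorFT_window e hlam hℓ hsum hW hvol ((RLin e ^ n) y), scaledCocycle_add,
        ← Matrix.mulVec_mulVec, pow_succ']
      congr 1
      rw [scaledCocycle, abs_det_R e hlam, Matrix.smul_mulVec]
      simp [cocycle]
  have hlim : Tendsto (fun n => (fun i => ((volume (W i)).toReal : ℂ)) -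
      fun i => indicatorFT (W i) ((RLin e ^ n) y)) atTop (𝓝 0) := by
    refine tendsto_pi_nhds.2 fun i => ?_
    have h1 := ((continuous_indicatorFT (hW.1 i).1).tendsto 0).comp (hR y)
    rw [indicatorFT_zero (hW.1 i).1.measurableSet] at h1
    simpa using h1.const_sub ((volume (W i)).toReal : ℂ)
  have h2 : Tendsto (fun n => scaledCocycle e ϱ ℓ n y *ᵥ ((fun i => ((volume (W i)).toReal : ℂ)) -
      fun i => indicatorFT (W i) ((RLin e ^ n) y))) atTop (𝓝 0) := by
    refine squeeze_zero_norm (fun n => hbound n y _) ?_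
    simpa using hlim.norm.const_mul K
  simp only [Matrix.mulVec_sub, hrec] at h2
  exact tendsto_sub_nhds_zero_iff.1 h2

end Cocycle

end PisotInflation

/-! ### Assembly of the main theorem -/

open PisotInflation in
theorem mainTheorem2 {A : Type*} [Fintype A] [DecidableEq A]
    -- a primitive substitution with Perron-Frobenius data `lam`, `u`, `v`
    (ϱ : A → List A) (hϱ : (PisotInflation.substMatrix ϱ).IsPrimitive)
    (lam : ℝ) (hlam : PisotInflation.IsPVUnit lam)
    (u v : A → ℝ) (hu : ∀ i, 0 < u i) (hv : ∀ i, 0 < v i)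
    (huM : u ᵥ* PisotInflation.substMatrix ϱ = lam • u)
    (hMv : PisotInflation.substMatrix ϱ *ᵥ v = lam • v)
    (hv1 : ∑ i, v i = 1) (huv : u ⬝ᵥ v = 1)
    -- natural tile lengths, chosen in `ℤ[lam]`
    (ℓ : A → PisotInflation.Fld lam)
    (hℓ : ∃ α : ℝ, 0 < α ∧ ∀ i, (ℓ i : ℝ) = α * u i)
    (hℓmem : ∀ i, (ℓ i : ℝ) ∈ Algebra.adjoin ℤ ({lam} : Set ℝ))
    -- the Minkowski embedding
    (r s : ℕ) (e : PisotInflation.ConjEnum lam r s) :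
    ∃ W : A → Set (PisotInflation.Internal r s),
      PisotInflation.IsWindowFamily e ϱ ℓ W ∧
      (∀ W', PisotInflation.IsWindowFamily e ϱ ℓ W' → W' = W) ∧
      ∃ (C : PisotInflation.Internal r s → Matrix A A ℂ)
        (c : PisotInflation.Internal r s → A → ℂ) (η : ℝ),
        (∀ y, Tendsto (fun n => PisotInflation.scaledCocycle e ϱ ℓ n y) atTop (𝓝 (C y))) ∧
        (∀ y, (C y).rank ≤ 1) ∧
        (∀ y, C y = Matrix.vecMulVec (c y) (fun i => (u i : ℂ))) ∧
        c 0 = (fun i => (v i : ℂ)) ∧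
        (∀ y, c y = C y *ᵥ (fun i => (v i : ℂ))) ∧
        0 < η ∧
        (∀ i, volume (W i) = ENNReal.ofReal (η * v i)) ∧
        (∀ y, (fun i => PisotInflation.indicatorFT (W i) y) = (η : ℂ) • c y) ∧
        (∀ y, Tendsto (fun n => (η : ℂ) •
            (PisotInflation.scaledCocycle e ϱ ℓ n y *ᵥ (fun i => (v i : ℂ)))) atTop
          (𝓝 (fun i => PisotInflation.indicatorFT (W i) y))) := by
  have hpos : 0 < lam := one_pos.trans hlam.one_lt
  have hA : Nonempty A := by
    by_contra h
    rw [not_nonempty_iff] at h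
    simp at hv1
  obtain ⟨α, hα, hℓu⟩ := hℓ
  have hℓpos (i : A) : 0 < (ℓ i : ℝ) := by
    rw [hℓu]
    exact mul_pos hα (hu i)
  have hsum (j : A) : (((ϱ j).map ℓ).sum : ℝ) = lam * ℓ j := by
    have h1 : (fun i => (ℓ i : ℝ)) = α • u := funext hℓu
    rw [coe_list_sum, list_sum_map_eq ϱ (fun i => (ℓ i : ℝ)), h1, Matrix.smul_vecMul, huM, hℓu]
    simp only [Pi.smul_apply, smul_eq_mul]
    ring
  have hℓint (i : A) : IsIntegral ℤ (ℓ i) :=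
    (isIntegral_algHom_iff ((Fld lam).val.restrictScalars ℤ) (x := ℓ i) Subtype.val_injective).1
      (adjoin_le_integralClosure hlam.isIntegral (hℓmem i))
  have hT (i : A) : ∃ j, (T ϱ ℓ i j).Nonempty := by
    have h1 : 0 < (substMatrix ϱ *ᵥ v) i := by
      rw [hMv]
      exact mul_pos hpos (hv i)
    obtain ⟨j, -, hj⟩ := Finset.exists_lt_of_sum_lt (s := Finset.univ) (f := fun _ : A => (0 : ℝ))
      (g := fun j => substMatrix ϱ i j * v j) (by rw [Finset.sum_const_zero]; exact h1)
    exact ⟨j, T_nonempty (pos_of_mul_pos_left hj (hv j).le)⟩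
  obtain ⟨ρ, hρ0, hρ1, hκ, hσ⟩ := e.exists_contraction_ratio hlam
  have hQ := norm_QLin_le e hρ0 hκ hσ
  have hR := tendsto_RLin_pow e hρ0 hρ1 hQ
  obtain ⟨W, hW, hWunique⟩ := existsUnique_isWindowFamily e ϱ ℓ hT (ρ := ⟨ρ, hρ0⟩) hρ1 hQ
  have hPprim : (scaledMatrix lam ϱ).IsPrimitive := by
    obtain ⟨k, hk, hk'⟩ := hϱ.exists_pos_pow
    refine ⟨fun i j => mul_nonneg (inv_nonneg.2 hpos.le) (hϱ.nonneg i j), k, hk, fun i j => ?_⟩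
    rw [smul_pow]
    exact mul_pos (pow_pos (inv_pos.2 hpos) k) (hk' i j)
  have huP : u ᵥ* scaledMatrix lam ϱ = u := by
    rw [Matrix.vecMul_smul, huM, inv_smul_smul₀ hpos.ne']
  have hPv : scaledMatrix lam ϱ *ᵥ v = v := by
    rw [Matrix.smul_mulVec, hMv, inv_smul_smul₀ hpos.ne']
  have hP := tendsto_pow_of_isPrimitive hPprim hu hv huP hPv huv
  -- Equality of volumes: the pieces of each window overlap without loss of measure.
  have hvol := mulVec_eq_of_le hu huP (volume_window_le e hlam hℓpos hsum hW)
  have hwv := eq_smul_of_mulVec_eq hPprim hu hv huP hPv huv hvol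
  set η : ℝ := u ⬝ᵥ fun j => (volume (W j)).toReal with hη
  have hηpos : 0 < η := by
    obtain ⟨i, hi⟩ := exists_volume_window_pos e hlam hℓint hℓpos hsum hW hρ0 hρ1 hQ
    refine Finset.sum_pos' (fun i _ => mul_nonneg (hu i).le ENNReal.toReal_nonneg)
      ⟨i, Finset.mem_univ i, mul_pos (hu i) (ENNReal.toReal_pos hi (hW.1 i).1.measure_ne_top)⟩
  have hηC : (η : ℂ) ≠ 0 := by exact_mod_cast hηpos.ne'
  have hwv' (i : A) : (volume (W i)).toReal = η * v i := congrFun hwv i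
  have hf (y : Internal r s) : Tendsto (fun n => (η : ℂ) •
      (scaledCocycle e ϱ ℓ n y *ᵥ fun i => (v i : ℂ))) atTop
      (𝓝 fun i => indicatorFT (W i) y) := by
    refine (tendsto_scaledCocycle_mulVec_window e hlam hℓpos hsum hP hR hW hvol y).congr fun n => ?_
    rw [← Matrix.mulVec_smul]
    congr 1
    ext i
    simp [hwv']
  -- Taking c = f/η supplies the limit on v explicitly, so its existence needs no separate Cauchy
  -- estimate.
  set c : Internal r s → A → ℂ := fun y => (η : ℂ)⁻¹ • fun i => indicatorFT (W i) y with hc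
  have hcv (y : Internal r s) : Tendsto (fun n => scaledCocycle e ϱ ℓ n y *ᵥ fun i => (v i : ℂ))
      atTop (𝓝 (c y)) := by
    refine ((hf y).const_smul (η : ℂ)⁻¹).congr fun n => ?_
    rw [inv_smul_smul₀ hηC]
  refine ⟨W, hW, hWunique, fun y => Matrix.vecMulVec (c y) fun i => (u i : ℂ), c, η,
    fun y => tendsto_scaledCocycle e hlam hℓpos hsum hP hR (hcv y),
    fun y => Matrix.rank_vecMulVec_le _ _, fun y => rfl, ?_, fun y => ?_, hηpos, fun i => ?_,
    fun y => ?_, hf⟩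
  · ext i
    simp only [hc, Pi.smul_apply, smul_eq_mul]
    rw [indicatorFT_zero (hW.1 i).1.measurableSet, hwv', Complex.ofReal_mul,
      inv_mul_cancel_left₀ hηC]
  · have h1 : (fun i => (u i : ℂ)) ⬝ᵥ (fun i => (v i : ℂ)) = 1 := by
      have := congrArg Complex.ofReal huv
      simpa [dotProduct] using this
    rw [Matrix.vecMulVec_mulVec, h1, op_smul_eq_smul, one_smul]
  · rw [← hwv', ENNReal.ofReal_toReal (hW.1 i).1.measure_ne_top]
  · rw [hc, smul_inv_smul₀ hηC]
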